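/- **Setting.** A UAV flies at fixed altitude; positions are points of $\mathbb{R}^2$. Given are an initial point $\mathbf u_0$ and a final point $\mathbf u_F$; base stations (BSs) at $\mathbf a_1,\dots,\mathbf a_M$ with effective coverage radii $r_m=d_0-\lambda_m$, $0\le\lambda_m\le d_0$, no two BSs having the same coverage disc; charging stations (CSs) at distinct points $\mathbf c_1,\dots,\mathbf c_N$ with replacement delays $\tau_1,\dots,\tau_N\ge 0$; speeds $\mathcal V=\{0,v_1,\dots,v_q\}$ with $0<v_1<\dots<v_q$, $q\ge 1$; the total weight $w=w_1+w_2+w_3$ of body, battery and payload; the propulsion power $$P(v)=P_1\Big(1+3\frac{v^2}{v_{\rm tip}^2}\Big)+P_2(w)\Big(\sqrt{1+0.25\,(v/v_0(w))^4}-0.5\,(v/v_0(w))^2\Big)^{1/2}+0.5\,S_{\rm FP}\,\rho\, v^3$$ with positive parameters; the battery capacity $C=\epsilon_{\rm batt}w_2>0$; $\gamma,\eta\in(0,1)$, $r_{\rm safe}>1$; and $d_{\rm fly}(v)=v\,\gamma\eta C/(r_{\rm safe}P(v))$. The coverage map is $\mathcal C=\bigcup_m\{\mathbf x:\|\mathbf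 x-\mathbf a_m\|\le r_m\}$. **Problem 2.** Over all $T\ge 0$, Lipschitz paths $\mathbf u:[0,T]\to\mathbb R^2$ and indicators $\psi:[0,T]\to\{0,1,\dots,N\}$ ($\psi=0$: airborne; $\psi=n$: staying at the $n$-th CS), with $\{\psi=0\}$ measurable, minimize the propulsion energy $$\int_{\{t\in[0,T]:\,\psi(t)=0\}}\frac{P(\|\dot{\mathbf u}(t)\|)}{\eta}\,dt$$ subject to: $\mathbf u(0)=\mathbf u_0$ and $\mathbf u(T)=\mathbf u_F$; $\|\dot{\mathbf u}(t)\|\in\mathcal V$ for almost every $t$; $\mathbf u(t)\in\mathcal C$ for all $t$; $\psi(t)=0$ if $\mathbf u(t)$ is not a CS, and $\psi(t)\in\{0,n\}$ if $\mathbf u(t)=\mathbf c_n$; and $E(t)\ge(1-\gamma/r_{\rm safe})C$ for all $t$. Here the battery level $E$ starts at $E(0)=C$, decreases at rate $P(\|\dot{\mathbf u}\|)/\eta$ while the UAV is airborne, is constant during stays, and is reset to $C$ at each time $t$ at which $\psi(t)=n\ge 1$ and the time elapsed since the UAV was last airborne (time $0$ if it was not airborne before) equals $\tau_n$. Precisely,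 $E(t)$ is $C$ minus the energy consumed while airborne during $[L(t),t]$, where $L(t)$ is the supremum of $0$ and all reset times up to $t$. **EGIM-B with step $\varepsilon>0$.** Treat $\mathbf c_{N+1}=\mathbf u_0$ and $\mathbf c_{N+2}=\mathbf u_F$ as further CSs with delay $0$. Let $V_{\rm in}$ be the set of all intersection points of the boundary circles of two different BSs, and $V_{\rm all}=V_{\rm in}\cup\{\mathbf c_1,\dots,\mathbf c_{N+2}\}$. 1. *Outage test.* For each pair of distinct $\mathbf x_1,\mathbf x_2\in V_{\rm all}$, put $\xi'=0$. While $\xi'<1$, take the first BS $m$ that covers the point of parameter $\xi'+\varepsilon$ on the line $\boldsymbol\alpha(\xi)=\mathbf x_1+\xi(\mathbf x_2-\mathbf x_1)$, and replace $\xi'$ by the largest $\xi\in[0,1]$ such that $\boldsymbol\alpha(\xi)$ is covered by $m$. If there is no such $m$, or if $\xi'$ does not change, the segment has an outage. If $\xi'=1$ is reached, the segment becomes an undirected edge, placed in $E_n$ for each $n\in\{1,\dots,N+2\}$ such that $\mathbf c_n$ is one of its ends, and in $E_{\rm in}$ if none of its ends is any $\mathbf c_n$. 2. *Local search.* For all $n\ne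 n'$ with $n\in\{1,\dots,N+1\}$ and $n'\in\{1,\dots,N\}\cup\{N+2\}$ such that $\mathbf c_n$ and $\mathbf c_{n'}$ can be joined within $\mathcal C$ at constant speed $v_q$, find a shortest path (Dijkstra), of length $\ell$ say, from $\mathbf c_n$ to $\mathbf c_{n'}$ in the graph with vertices $V_{\rm in}\cup\{\mathbf c_n,\mathbf c_{n'}\}$ and edges $E_{\rm in}\cup E_n\cup E_{n'}$ weighted by length. If such a path exists and some $v\in\mathcal V\setminus\{0\}$ has $d_{\rm fly}(v)\ge\ell$, choose among these $v$ one that minimizes the energy per unit distance $P(v)/(\eta v)$, and add the directed edge $(n,n')$ with weight $\frac{\ell}{v}\cdot\frac{P(v)}{\eta}$ to the global graph. 3. *Global search.* If the global graph has no path from $N+1$ to $N+2$, report that there is no solution. Otherwise find a path of minimum total weight (Dijkstra), and output the trajectory that flies the local paths along it at their chosen speeds and stays at each CS reached for exactly its delay. Ties are broken arbitrarily. **Proposition.** For every such instance there is an $\varepsilon_0>0$ such that for every $\varepsilon\in(0,\varepsilon_0)$: EGIM-B has an output; every trajectory that it can output is an optimal solution of Problem 2, that is, it satisfies all the constraints and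 has the least propulsion energy among all feasible trajectories; and if it reports that there is no solution, then Problem 2 has no feasible trajectory. -/

import Mathlib

/-- The horizontal plane with its Euclidean norm. -/
abbrev Plane := EuclideanSpace ℝ (Fin 2)

/-! ### The model -/

/-- The data of a mission in a cellular network with `M` base stations (BSs) and `N` charging
stations (CSs). All positions are horizontal projections; the altitude is fixed, and the charging
stations are at flight altitude. -/
structure Mission (M N : ℕ) where
  /-- initial and final point -/
  u₀ : Plane
  uF : Plane
  /-- locations of the BSs, base coverage radius and coverage offsets -/
  a : Fin M → Plane
  d₀ : ℝ
  lam : Fin M → ℝ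
  lam_nonneg : ∀ m, 0 ≤ lam m
  lam_le : ∀ m, lam m ≤ d₀
  /-- no two BSs have one and the same effective coverage disc (so that two coverage boundaries
  meet in finitely many points) -/
  disc_ne : ∀ m m', m ≠ m' → a m = a m' → lam m ≠ lam m'
  /-- locations of the CSs and battery replacement delays -/
  c : Fin N → Plane
  c_injective : Function.Injective c
  tau : Fin N → ℝ
  tau_nonneg : ∀ n, 0 ≤ tau n
  /-- the positive flight speeds `v₁ < ⋯ < v_q` -/
  speeds : Finset ℝ
  speeds_nonempty : speeds.Nonempty
  speeds_pos : ∀ v ∈ speeds, 0 < v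
  /-- weights of the body, of the battery and of the payload -/
  w₁ : ℝ
  w₂ : ℝ
  w₃ : ℝ
  w₁_pos : 0 < w₁
  w₂_pos : 0 < w₂
  w₃_nonneg : 0 ≤ w₃
  /-- parameters of the propulsion power; `P₂` and `v₀` depend on the total weight -/
  P₁ : ℝ
  P₂ : ℝ → ℝ
  v₀ : ℝ → ℝ
  vtip : ℝ
  SFP : ℝ
  rho : ℝ
  P₁_pos : 0 < P₁
  P₂_pos : 0 < P₂ (w₁ + w₂ + w₃)
  v₀_pos : 0 < v₀ (w₁ + w₂ + w₃)
  vtip_pos : 0 < vtip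
  SFP_pos : 0 < SFP
  rho_pos : 0 < rho
  /-- parameters of the battery: energy density, depth of discharge, transferable ratio, energy
  reserving factor -/
  epsBatt : ℝ
  gam : ℝ
  eta : ℝ
  rsafe : ℝ
  epsBatt_pos : 0 < epsBatt
  gam_pos : 0 < gam
  gam_lt : gam < 1
  eta_pos : 0 < eta
  eta_lt : eta < 1
  rsafe_gt : 1 < rsafe

/-- A candidate solution: the mission time `T`, the path `u`, and the indicator `ψ`, where
`ψ t = none` means that the UAV is airborne at time `t` and `ψ t = some n` that it stays at the
`n`-th CS. Only the values at times in `[0, T]` matter. -/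
structure Trajectory (N : ℕ) where
  T : ℝ
  u : ℝ → Plane
  ψ : ℝ → Option (Fin N)

namespace Mission

noncomputable section

variable {M N : ℕ} (I : Mission M N)

/-- Total weight. -/
def w : ℝ := I.w₁ + I.w₂ + I.w₃

/-- The set `{0, v₁, …, v_q}` of admissible speeds. -/
def speedSet : Set ℝ := insert 0 (I.speeds : Set ℝ)

/-- The largest speed `v_q`. -/
def vmax : ℝ := I.speeds.max' I.speeds_nonempty

/-- Propulsion power during flight at speed `v`. -/
def power (v : ℝ) : ℝ :=
  I.P₁ * (1 + 3 * (v / I.vtip) ^ 2)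
    + I.P₂ I.w * Real.sqrt (Real.sqrt (1 + 0.25 * (v / I.v₀ I.w) ^ 4) - 0.5 * (v / I.v₀ I.w) ^ 2)
    + 0.5 * I.SFP * I.rho * v ^ 3

/-- Capacity of the battery. -/
def capacity : ℝ := I.epsBatt * I.w₂

/-- Maximum flight distance at constant speed `v` with one battery. -/
def dfly (v : ℝ) : ℝ := v * (I.gam * I.eta * I.capacity / (I.rsafe * I.power v))

/-- Effective coverage radius of a BS. -/
def radius (m : Fin M) : ℝ := I.d₀ - I.lam m

/-- `x` lies in the total coverage map: `min_m ‖x - a_m‖ + lam_m ≤ d₀`. -/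
def Covered (x : Plane) : Prop := ∃ m, ‖x - I.a m‖ + I.lam m ≤ I.d₀

/-! ### The optimization problem -/

/-- The last airborne time up to time `t` (a supremum: the UAV may dock at the very instant at
which its flight ends). -/
def lastAirborne (p : Trajectory N) (t : ℝ) : ℝ :=
  sSup {t₁ | t₁ ∈ Set.Icc 0 t ∧ p.ψ t₁ = none}

/-- At time `t` the battery is replaced by a fully charged one: the UAV stays at a CS, and the time
since it was last airborne equals the delay of that CS. -/
def IsSwap (p : Trajectory N) (t : ℝ) : Prop :=
  ∃ n, p.ψ t = some n ∧ t - lastAirborne p t = I.tau n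

/-- The last time up to `t` at which the UAV had a fresh battery, which is time `0` if there was no
replacement. -/
def lastFull (p : Trajectory N) (t : ℝ) : ℝ :=
  sSup (insert 0 {s | s ∈ Set.Icc 0 t ∧ I.IsSwap p s})

/-- The propulsion energy consumed during `[s, t]`: the integral of `P_UAV(v) / η` over the airborne
time, where `v = ‖∇u‖` is the speed. No energy is consumed during a stay at a CS. -/
def energyUsed (p : Trajectory N) (s t : ℝ) : ℝ :=
  ∫ x in {x | x ∈ Set.Icc s t ∧ p.ψ x = none}, I.power ‖deriv p.u x‖ / I.eta

/-- The remaining energy of the battery at time `t`: the capacity minus what was consumed since the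
battery was last fully charged. This is the solution of `E(0) = C`, `-E' = P_UAV(v) / η` while
airborne, `E' = 0` during a stay at a CS, and `E = C` at the battery replacements. -/
def battery (p : Trajectory N) (t : ℝ) : ℝ :=
  I.capacity - I.energyUsed p (I.lastFull p t) t

/-- The constraints of the problem. The path is Lipschitz (equivalently, absolutely continuous, as
its speed is bounded), and its speed, which is not defined at breakpoints, is constrained at almost
every time. -/
structure IsFeasible (p : Trajectory N) : Prop where
  time_nonneg : 0 ≤ p.T
  initial : p.u 0 = I.u₀
  final : p.u p.T = I.uF
  lipschitz : ∃ K, LipschitzOnWith K p.u (Set.Icc 0 p.T)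
  speed : ∀ᵐ t, t ∈ Set.Icc 0 p.T →
    DifferentiableAt ℝ p.u t ∧ ‖deriv p.u t‖ ∈ I.speedSet
  measurable_airborne : MeasurableSet {t | t ∈ Set.Icc 0 p.T ∧ p.ψ t = none}
  connected : ∀ t ∈ Set.Icc 0 p.T, I.Covered (p.u t)
  airborne : ∀ t ∈ Set.Icc 0 p.T, (∀ n, p.u t ≠ I.c n) → p.ψ t = none
  docked : ∀ t ∈ Set.Icc 0 p.T, ∀ n, p.u t = I.c n → p.ψ t = none ∨ p.ψ t = some n
  energy : ∀ t ∈ Set.Icc 0 p.T, (1 - I.gam / I.rsafe) * I.capacity ≤ I.battery p t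

/-- The objective: the total propulsion energy. -/
def totalEnergy (p : Trajectory N) : ℝ := I.energyUsed p 0 p.T

/-- `p` is an optimal solution of the minimum energy problem. -/
def IsOptimal (p : Trajectory N) : Prop :=
  I.IsFeasible p ∧ ∀ p', I.IsFeasible p' → I.totalEnergy p ≤ I.totalEnergy p'

/-! ### Subroutines of the algorithm -/

/-- `ChkFea`: there is a path from `x` to `y` at constant speed `v_q` within the coverage map. -/
def ChkFea (x y : Plane) : Prop :=
  ∃ (T : ℝ) (u : ℝ → Plane), 0 ≤ T ∧ u 0 = x ∧ u T = y ∧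
    (∃ K, LipschitzOnWith K u (Set.Icc 0 T)) ∧
    (∀ᵐ t, t ∈ Set.Icc 0 T → DifferentiableAt ℝ u t ∧ ‖deriv u t‖ = I.vmax) ∧
    ∀ t ∈ Set.Icc 0 T, I.Covered (u t)

/-- The point with parameter `ξ` on the line through `x₁` and `x₂` lies in the effective coverage
region of the `m`-th BS. -/
def CoversAt (x₁ x₂ : Plane) (m : Fin M) (ξ : ℝ) : Prop :=
  ‖x₁ + ξ • (x₂ - x₁) - I.a m‖ ≤ I.radius m

/-- The values taken by the variable `ξ'` (the right end of the safe interval) in the loop of the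
function `ChkOut` with step `ε`: as long as `ξ' < 1`, take the first BS that covers the point with
parameter `ξ' + ε`, and replace `ξ'` by the largest parameter in `[0, 1]` covered by that BS; if
there is no such BS or if `ξ'` does not change, the loop is left. -/
inductive SafeUpTo (ε : ℝ) (x₁ x₂ : Plane) : ℝ → Prop
  | zero : SafeUpTo ε x₁ x₂ 0
  | step {ξ ξ' : ℝ} (m : Fin M) : SafeUpTo ε x₁ x₂ ξ → ξ < 1 →
      I.CoversAt x₁ x₂ m (ξ + ε) → (∀ m' < m, ¬ I.CoversAt x₁ x₂ m' (ξ + ε)) →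
      IsGreatest {s | s ∈ Set.Icc (0 : ℝ) 1 ∧ I.CoversAt x₁ x₂ m s} ξ' → ξ' ≠ ξ →
      SafeUpTo ε x₁ x₂ ξ'

/-- `ChkOut` with step `ε` returns `0` (no outage): the safe interval has become `[0, 1]`. -/
def NoOutage (ε : ℝ) (x₁ x₂ : Plane) : Prop := I.SafeUpTo ε x₁ x₂ 1

end

end Mission

/-- `S` is a sequence of vertices that starts in `x`, ends in `y`, and follows edges. -/
def IsVisitingSeq {α : Type*} (adj : α → α → Prop) (x y : α) (S : List α) : Prop :=
  S.IsChain adj ∧ S.head? = some x ∧ S.getLast? = some y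

/-- The aggregate weight of a sequence of vertices. -/
def aggWeight {α : Type*} (wt : α → α → ℝ) : List α → ℝ
  | x :: y :: l => wt x y + aggWeight wt (y :: l)
  | _ => 0

/-- `Dijkstra` from `x` to `y` on the graph with edges `adj` and weights `wt` may return `S`, a
visiting sequence of minimum aggregate weight (ties are broken arbitrarily). -/
def IsDijkstraOutput {α : Type*} (adj : α → α → Prop) (wt : α → α → ℝ) (x y : α)
    (S : List α) : Prop :=
  IsVisitingSeq adj x y S ∧ ∀ S', IsVisitingSeq adj x y S' → aggWeight wt S ≤ aggWeight wt S'

/-- The vertices of the global graph: the CSs, and the initial and the final point, which are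
treated as CSs. -/
inductive Node (N : ℕ) : Type
  | cs (n : Fin N) : Node N
  | start : Node N
  | goal : Node N

/-- A phase of a flight plan: fly straight from `x` to `y` at speed `v`, or stay at a CS for the
battery replacement. -/
inductive Phase (N : ℕ) : Type
  | fly (x y : Plane) (v : ℝ) : Phase N
  | dock (n : Fin N) : Phase N

/-- Fly along a sequence of points at speed `v`. -/
def flyAlong (N : ℕ) (v : ℝ) : List Plane → List (Phase N)
  | x :: y :: l => Phase.fly x y v :: flyAlong N v (y :: l)
  | _ => []

/-- The stay at a vertex of the global graph. -/
def dockAt {N : ℕ} : Node N → List (Phase N)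
  | Node.cs n => [Phase.dock n]
  | _ => []

/-- The results of the local level search: for a pair of nodes, either nothing, or a sequence of
points from the one to the other and a speed. -/
abbrev LocalTable (N : ℕ) := Node N → Node N → Option (List Plane × ℝ)

/-- The flight plan of a sequence of nodes: between two nodes follow the local path at the local
speed, and at each CS reached replace the battery. -/
def flightPlan {N : ℕ} (loc : LocalTable N) : List (Node N) → List (Phase N)
  | n :: n' :: l =>
      (match loc n n' with
        | some (S, v) => flyAlong N v S
        | none => []) ++ dockAt n' ++ flightPlan loc (n' :: l)
  | _ => []

namespace Mission

noncomputable section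

variable {M N : ℕ} (I : Mission M N)

/-! ### Graphs -/

/-- Position of a node. -/
def pos : Node N → Plane
  | Node.cs n => I.c n
  | Node.start => I.u₀
  | Node.goal => I.uF

/-- The intersection points of the coverage boundaries. -/
def Vin : Set Plane :=
  {x | ∃ m m', m < m' ∧ ‖I.a m - I.a m'‖ ≤ I.radius m + I.radius m' ∧
    ‖x - I.a m‖ = I.radius m ∧ ‖x - I.a m'‖ = I.radius m'}

/-- All vertices. -/
def Vall : Set Plane := Set.range I.pos ∪ I.Vin

/-- The pair `x`, `y` survives the outage test (the loop runs over all ordered pairs, and edges are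
undirected). -/
def Survives (ε : ℝ) (x y : Plane) : Prop :=
  x ∈ I.Vall ∧ y ∈ I.Vall ∧ x ≠ y ∧ (I.NoOutage ε x y ∨ I.NoOutage ε y x)

/-- The edges at a node. -/
def edgeAt (ε : ℝ) (n : Node N) (x y : Plane) : Prop :=
  I.Survives ε x y ∧ (I.pos n = x ∨ I.pos n = y)

/-- The edges at no node. -/
def edgeIn (ε : ℝ) (x y : Plane) : Prop :=
  I.Survives ε x y ∧ ∀ n, I.pos n ≠ x ∧ I.pos n ≠ y

/-- Vertices of the local graph of a pair of nodes. -/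
def Vloc (n n' : Node N) : Set Plane := I.Vin ∪ {I.pos n, I.pos n'}

/-- Edges of the local graph of a pair of nodes. -/
def adjLoc (ε : ℝ) (n n' : Node N) (x y : Plane) : Prop :=
  x ∈ I.Vloc n n' ∧ y ∈ I.Vloc n n' ∧
    (I.edgeIn ε x y ∨ I.edgeAt ε n x y ∨ I.edgeAt ε n' x y)

/-- The length of a sequence of points. -/
def pathLength (S : List Plane) : ℝ := aggWeight (fun x y => ‖x - y‖) S

/-- The speed check: `v` is a positive speed at which the length `ℓ` can be flown with one battery,
and among these it minimizes the energy per unit distance. -/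
def IsChosenSpeed (ℓ v : ℝ) : Prop :=
  v ∈ I.speeds ∧ ℓ ≤ I.dfly v ∧
    ∀ v' ∈ I.speeds, ℓ ≤ I.dfly v' → I.power v / (I.eta * v) ≤ I.power v' / (I.eta * v')

/-- The local search for the pair `n`, `n'` may return the path `S` and the speed `v`. -/
def IsLocalResult (ε : ℝ) (n n' : Node N) (S : List Plane) (v : ℝ) : Prop :=
  n ≠ Node.goal ∧ n' ≠ Node.start ∧ n ≠ n' ∧ I.ChkFea (I.pos n) (I.pos n') ∧
    IsDijkstraOutput (I.adjLoc ε n n') (fun x y => ‖x - y‖) (I.pos n) (I.pos n') S ∧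
    I.IsChosenSpeed (pathLength S) v

/-- `loc` is a possible outcome of the local level search: for each pair of nodes it holds a
possible result, or nothing if there is none. -/
def IsLocalTable (ε : ℝ) (loc : LocalTable N) : Prop :=
  ∀ n n', (∀ S v, loc n n' = some (S, v) → I.IsLocalResult ε n n' S v) ∧
    (loc n n' = none → ∀ S v, ¬ I.IsLocalResult ε n n' S v)

/-- Edges of the directed global graph. -/
def adjGlob (loc : LocalTable N) (n n' : Node N) : Prop := (loc n n').isSome

/-- Weights of the global graph: the energy for flying the local path at the local speed. -/
def weightGlob (loc : LocalTable N) (n n' : Node N) : ℝ :=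
  match loc n n' with
  | some (S, v) => pathLength S / v * (I.power v / I.eta)
  | none => 0

/-! ### The output trajectory -/

/-- Duration of a phase. -/
def duration : Phase N → ℝ
  | Phase.fly x y v => ‖x - y‖ / v
  | Phase.dock n => I.tau n

/-- Position at time `t` of a flight plan; it rests at the final point afterwards. -/
def planPos : List (Phase N) → ℝ → Plane
  | [], _ => I.uF
  | Phase.fly x y v :: l, t =>
      if t < ‖x - y‖ / v then x + (t / (‖x - y‖ / v)) • (y - x)
      else planPos l (t - ‖x - y‖ / v)
  | Phase.dock n :: l, t => if t ≤ I.tau n then I.c n else planPos l (t - I.tau n)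

/-- Indicator at time `t` of a flight plan; a stay at a CS includes both its end points. -/
def planInd : List (Phase N) → ℝ → Option (Fin N)
  | [], _ => none
  | Phase.fly x y v :: l, t =>
      if t < ‖x - y‖ / v then none else planInd l (t - ‖x - y‖ / v)
  | Phase.dock n :: l, t => if t ≤ I.tau n then some n else planInd l (t - I.tau n)

/-- `FindPathG`: the trajectory of a sequence of nodes. -/
def findPath (loc : LocalTable N) (S : List (Node N)) : Trajectory N where
  T := ((flightPlan loc S).map I.duration).sum
  u := I.planPos (flightPlan loc S)
  ψ := I.planInd (flightPlan loc S)

/-- `out` is a possible output of EGIM-B whose outage test uses the step `ε`; `none` is the output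
in the case that the global graph has no path from the initial to the final point. -/
def IsOutput (ε : ℝ) (out : Option (Trajectory N)) : Prop :=
  ∃ loc : LocalTable N, I.IsLocalTable ε loc ∧
    ((∃ S, IsDijkstraOutput (adjGlob loc) (I.weightGlob loc) Node.start Node.goal S ∧
        out = some (I.findPath loc S)) ∨
      ((¬ ∃ S, IsVisitingSeq (adjGlob loc) Node.start Node.goal S) ∧ out = none))

end

end Mission

/-! ### Visiting sequences -/

section VisitingSeq

variable {α : Type*} {adj adj' : α → α → Prop} {wt : α → α → ℝ} {x y z : α} {S l : List α}

/-! Discretisation. On a fixed segment the loop variable of the outage test takes values in a finite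
set that does not depend on `ε`. So for small `ε` a disc that is seen at `ξ' + ε` already covers
`ξ'`, and the test accepts exactly the segments inside the coverage map (`eventually_noOutage_iff`).
As `Vall` is finite, one `ε₀` serves all pairs.

Upper bound. A path in the global graph turns into a flight plan that obeys all the constraints and
whose energy is the weight of the path (`isFeasible_findPath`).

Lower bound. Let `minCost` be the least energy per unit distance over the admissible speeds. Any
part of a feasible trajectory consumes at least `minCost` times the length of some chain of points
in which neighbours share a coverage disc (`exists_discChain`). A shortest such chain bends only
where two boundary circles meet, so the chain can be traded for a polygon, no longer than it, with
inner vertices in `Vin` (`Mission.exists_polygon`). A speed `v` can fly the length `ℓ` iff `cost v *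
ℓ ≤ budget`. Hence as soon as some speed can, one of least cost can, and the chosen speed has cost
`minCost`. A polygon within the budget therefore yields a path in the global graph of weight at most
`minCost` times its length (`Reach.step`, `reach_of_polygon`).

A feasible trajectory is traced back along legs that start at time `0` or at a charging station and
consume at most the budget each (`exists_leg_start`). Joining their replacements gives a path to the
goal of weight at most the total energy (`reach_goal`). So a path of minimum weight is optimal, and
without a path to the goal there is no feasible trajectory. -/

theorem isVisitingSeq_singleton : IsVisitingSeq adj x x [x] := by
  simp [IsVisitingSeq]

theorem IsVisitingSeq.exists_eq_cons (h : IsVisitingSeq adj x y S) : ∃ l, S = x :: l := by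
  obtain ⟨-, h, -⟩ := h
  cases S with
  | nil => simp at h
  | cons a l => exact ⟨l, by simpa using h⟩

theorem isVisitingSeq_cons_cons :
    IsVisitingSeq adj x z (x :: y :: l) ↔ adj x y ∧ IsVisitingSeq adj y z (y :: l) := by
  simp [IsVisitingSeq, List.getLast?_cons_cons, and_assoc]

theorem IsVisitingSeq.cons (h : IsVisitingSeq adj y z S) (hxy : adj x y) :
    IsVisitingSeq adj x z (x :: S) := by
  obtain ⟨l, rfl⟩ := h.exists_eq_cons
  exact isVisitingSeq_cons_cons.2 ⟨hxy, h⟩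

theorem IsVisitingSeq.concat (h : IsVisitingSeq adj x y S) (hyz : adj y z) :
    IsVisitingSeq adj x z (S ++ [z]) := by
  refine ⟨List.isChain_append.2 ⟨h.1, List.isChain_singleton _, ?_⟩, ?_, by simp⟩
  · simp only [h.2.2]
    simpa using hyz
  · simp [h.2.1]

/-- Induction along a visiting sequence, from its end. -/
theorem IsVisitingSeq.induction {motive : α → List α → Prop} (h : IsVisitingSeq adj x z S)
    (last : motive z [z])
    (step : ∀ a b l, adj a b → IsVisitingSeq adj b z (b :: l) → motive b (b :: l) →
      motive a (a :: b :: l)) : motive x S := by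
  induction S generalizing x with
  | nil => simp [IsVisitingSeq] at h
  | cons a l ih =>
    obtain rfl : a = x := by simpa using h.2.1
    cases l with
    | nil =>
      obtain rfl : a = z := by simpa using h.2.2
      exact last
    | cons b l =>
      obtain ⟨hab, hb⟩ := isVisitingSeq_cons_cons.1 h
      exact step a b l hab hb (ih hb)

theorem IsVisitingSeq.mono (h : IsVisitingSeq adj x y S) (hadj : ∀ a b, adj a b → adj' a b) :
    IsVisitingSeq adj' x y S :=
  ⟨h.1.imp hadj, h.2⟩

theorem aggWeight_append_cons (l₁ l₂ : List α) (a : α) :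
    aggWeight wt (l₁ ++ a :: l₂) = aggWeight wt (l₁ ++ [a]) + aggWeight wt (a :: l₂) := by
  induction l₁ with
  | nil => simp [aggWeight]
  | cons b l₁ ih =>
    cases l₁ with
    | nil => simp [aggWeight]
    | cons c l₁ =>
      simp only [List.cons_append, aggWeight] at ih ⊢
      rw [ih, add_assoc]

theorem IsVisitingSeq.aggWeight_concat (h : IsVisitingSeq adj x y S) :
    aggWeight wt (S ++ [z]) = aggWeight wt S + wt y z := by
  obtain ⟨l, rfl⟩ := List.getLast?_eq_some_iff.1 h.2.2
  rw [List.append_assoc, List.singleton_append, aggWeight_append_cons]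
  simp [aggWeight]

theorem aggWeight_nonneg (h : ∀ a b, 0 ≤ wt a b) (S : List α) : 0 ≤ aggWeight wt S := by
  induction S with
  | nil => simp [aggWeight]
  | cons a l ih =>
    cases l with
    | nil => simp [aggWeight]
    | cons b l => simpa only [aggWeight] using add_nonneg (h a b) ih

/-- A finite graph with nonnegative weights has a path of least weight from `x` to `y` if it has a
path at all. -/
theorem exists_isDijkstraOutput {V : Set α} (hV : V.Finite)
    (hadj : ∀ a b, adj a b → a ∈ V ∧ b ∈ V) (hwt : ∀ a b, 0 ≤ wt a b)
    (hS : IsVisitingSeq adj x y S) : ∃ S', IsDijkstraOutput adj wt x y S' := by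
  set E : Set ℝ := (fun p : α × α => wt p.1 p.2) '' V ×ˢ V
  -- There may be infinitely many walks, but their weights lie in the additive monoid generated by
  -- finitely many nonnegative reals. That monoid is partially well-ordered, so the least weight is
  -- attained.
  have hpwo : (AddSubmonoid.closure E : Set ℝ).IsPWO :=
    Set.IsPWO.addSubmonoid_closure (by rintro _ ⟨p, -, rfl⟩; exact hwt _ _)
      ((hV.prod hV).image _).isPWO
  have hmem : ∀ {S}, IsVisitingSeq adj x y S → aggWeight wt S ∈ AddSubmonoid.closure E := by
    intro S hS
    refine hS.induction (motive := fun _ S => aggWeight wt S ∈ AddSubmonoid.closure E)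
      (AddSubmonoid.zero_mem _) fun a b l hab _ ih => ?_
    exact AddSubmonoid.add_mem _ (AddSubmonoid.subset_closure ⟨(a, b), hadj a b hab, rfl⟩) ih
  have hwf : (aggWeight wt '' {S | IsVisitingSeq adj x y S}).IsWF :=
    hpwo.isWF.mono (by rintro _ ⟨S, hS, rfl⟩; exact hmem hS)
  have hne : (aggWeight wt '' {S | IsVisitingSeq adj x y S}).Nonempty := ⟨_, S, hS, rfl⟩
  obtain ⟨S', hS', heq⟩ := hwf.min_mem hne
  refine ⟨S', hS', fun S'' hS'' => ?_⟩
  rw [heq]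
  exact hwf.min_le hne ⟨S'', hS'', rfl⟩

end VisitingSeq

namespace Mission

open Set Filter Topology Metric

variable {M N : ℕ} (I : Mission M N)

/-! ### Coverage and the outage test -/

/-- The effective coverage disc of a BS. -/
def disc (m : Fin M) : Set Plane := closedBall (I.a m) (I.radius m)

/-- The coverage map. -/
def coverage : Set Plane := ⋃ m, I.disc m

theorem covered_iff {x : Plane} : I.Covered x ↔ x ∈ I.coverage := by
  simp only [Covered, coverage, disc, radius, mem_iUnion, mem_closedBall, dist_eq_norm,
    le_sub_iff_add_le]

theorem isClosed_disc (m : Fin M) : IsClosed (I.disc m) := isClosed_closedBall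

theorem convex_disc (m : Fin M) : Convex ℝ (I.disc m) := convex_closedBall _ _

theorem isCompact_coverage : IsCompact I.coverage :=
  isCompact_iUnion fun _ => isCompact_closedBall _ _

theorem coversAt_iff {x₁ x₂ : Plane} {m : Fin M} {s : ℝ} :
    I.CoversAt x₁ x₂ m s ↔ AffineMap.lineMap x₁ x₂ s ∈ I.disc m := by
  rw [CoversAt, disc, mem_closedBall, dist_eq_norm, AffineMap.lineMap_apply, vsub_eq_sub,
    vadd_eq_add, add_comm x₁]

theorem isClosed_coversAt (x₁ x₂ : Plane) (m : Fin M) : IsClosed {s | I.CoversAt x₁ x₂ m s} := by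
  simp only [coversAt_iff]
  exact (I.isClosed_disc m).preimage AffineMap.lineMap_continuous

theorem ordConnected_coversAt (x₁ x₂ : Plane) (m : Fin M) :
    OrdConnected {s | I.CoversAt x₁ x₂ m s} := by
  simp only [coversAt_iff]
  exact ((I.convex_disc m).affine_preimage (AffineMap.lineMap x₁ x₂)).ordConnected

theorem segment_subset_coverage_iff {x₁ x₂ : Plane} :
    segment ℝ x₁ x₂ ⊆ I.coverage ↔ ∀ s ∈ Icc (0 : ℝ) 1, ∃ m, I.CoversAt x₁ x₂ m s := by
  simp only [segment_eq_image_lineMap, image_subset_iff, coversAt_iff, coverage]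
  simp [subset_def]

/-- The values that the loop variable of the outage test can take, whatever the step. -/
def loopValues (x₁ x₂ : Plane) : Set ℝ :=
  insert 0 {ξ | ∃ m, IsGreatest {s | s ∈ Icc (0 : ℝ) 1 ∧ I.CoversAt x₁ x₂ m s} ξ}

theorem finite_loopValues (x₁ x₂ : Plane) : (I.loopValues x₁ x₂).Finite := by
  refine Finite.insert _ ?_
  have : {ξ | ∃ m, IsGreatest {s | s ∈ Icc (0 : ℝ) 1 ∧ I.CoversAt x₁ x₂ m s} ξ} =
      ⋃ m, {ξ | IsGreatest {s | s ∈ Icc (0 : ℝ) 1 ∧ I.CoversAt x₁ x₂ m s} ξ} := by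
    ext; simp
  rw [this]
  exact finite_iUnion fun m => Subsingleton.finite fun a ha b hb => ha.unique hb

theorem mem_Icc_of_mem_loopValues {x₁ x₂ : Plane} {ξ : ℝ} (h : ξ ∈ I.loopValues x₁ x₂) :
    ξ ∈ Icc (0 : ℝ) 1 := by
  obtain rfl | ⟨m, h⟩ := h
  · simp
  · exact h.1.1

theorem SafeUpTo.mem_loopValues {I : Mission M N} {ε ξ : ℝ} {x₁ x₂ : Plane}
    (h : I.SafeUpTo ε x₁ x₂ ξ) : ξ ∈ I.loopValues x₁ x₂ := by
  cases h with
  | zero => exact mem_insert _ _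
  | step m _ _ _ _ h _ => exact Or.inr ⟨m, h⟩

/-- For all small steps, the outage test is correct. -/
theorem eventually_noOutage_iff (x₁ x₂ : Plane) :
    ∀ᶠ ε in 𝓝[>] (0 : ℝ), I.NoOutage ε x₁ x₂ ↔ segment ℝ x₁ x₂ ⊆ I.coverage := by
  have h₁ : ∀ᶠ ε in 𝓝[>] (0 : ℝ), ∀ ξ ∈ I.loopValues x₁ x₂, ξ < 1 → ξ + ε < 1 := by
    rw [eventually_all_finite (I.finite_loopValues x₁ x₂)]
    intro ξ _
    by_cases hξ : ξ < 1
    · filter_upwards [Ioo_mem_nhdsGT (sub_pos.2 hξ)] with ε hε _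
      linarith [hε.2]
    · exact Eventually.of_forall fun ε h => absurd h hξ
  -- A disc that misses `ξ` misses a neighbourhood of `ξ`, hence also `ξ + ε` for small `ε`; there
  -- are finitely many pairs of a value and a disc.
  have h₂ : ∀ᶠ ε in 𝓝[>] (0 : ℝ), ∀ ξ ∈ I.loopValues x₁ x₂, ∀ m,
      I.CoversAt x₁ x₂ m (ξ + ε) → I.CoversAt x₁ x₂ m ξ := by
    rw [eventually_all_finite (I.finite_loopValues x₁ x₂)]
    intro ξ _
    rw [eventually_all]
    intro m
    by_cases hm : I.CoversAt x₁ x₂ m ξ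
    · exact Eventually.of_forall fun _ _ => hm
    · have hopen : ∀ᶠ s in 𝓝 ξ, ¬ I.CoversAt x₁ x₂ m s :=
        (I.isClosed_coversAt x₁ x₂ m).isOpen_compl.mem_nhds hm
      have htend : Tendsto (fun ε : ℝ => ξ + ε) (𝓝[>] 0) (𝓝 ξ) := by
        have : Tendsto (fun ε : ℝ => ξ + ε) (𝓝 0) (𝓝 (ξ + 0)) :=
          (continuous_const.add continuous_id).tendsto 0
        rw [add_zero] at this
        exact this.mono_left nhdsWithin_le_nhds
      filter_upwards [htend.eventually hopen] with ε hε h using absurd h hε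
  filter_upwards [h₁, h₂, self_mem_nhdsWithin] with ε h₁ h₂ (hε : 0 < ε)
  rw [segment_subset_coverage_iff]
  constructor
  · intro h
    -- Invariant of the loop. Initially nothing has been tested, not even the parameter `0`, so the
    -- value `0` is exempt.
    have key : ∀ ξ, I.SafeUpTo ε x₁ x₂ ξ →
        ξ = 0 ∨ ∀ s ∈ Icc (0 : ℝ) ξ, ∃ m, I.CoversAt x₁ x₂ m s := by
      intro ξ h
      induction h with
      | zero => exact Or.inl rfl
      | @step ξ ξ' m hs _ hm _ hgr _ ih =>
        refine Or.inr fun s hsI => ?_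
        rcases le_or_gt ξ s with hle | hlt
        · exact ⟨m, (I.ordConnected_coversAt x₁ x₂ m).out (h₂ ξ hs.mem_loopValues m hm)
            hgr.1.2 ⟨hle, hsI.2⟩⟩
        · rcases ih with rfl | ih
          · exact absurd hsI.1 (not_le.2 hlt)
          · exact ih s ⟨hsI.1, hlt.le⟩
    exact (key 1 h).resolve_left one_ne_zero
  · intro hcov
    -- Termination: the largest value that the loop can reach must be `1`, since from a value `ξ <
    -- 1` on a covered segment the loop moves on to at least `ξ + ε`.
    obtain ⟨ξ, hξ, hmax⟩ := Set.exists_max_image {ξ | I.SafeUpTo ε x₁ x₂ ξ} id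
      ((I.finite_loopValues x₁ x₂).subset fun _ h => h.mem_loopValues) ⟨0, SafeUpTo.zero⟩
    have hξF := SafeUpTo.mem_loopValues hξ
    have hξI := I.mem_Icc_of_mem_loopValues hξF
    rcases hξI.2.eq_or_lt with rfl | hlt
    · exact hξ
    have hmem : ξ + ε ∈ Icc (0 : ℝ) 1 := ⟨by linarith [hξI.1], (h₁ ξ hξF hlt).le⟩
    obtain ⟨m, hm, hmin⟩ := WellFounded.has_min (wellFounded_lt (α := Fin M))
      {m | I.CoversAt x₁ x₂ m (ξ + ε)} (hcov _ hmem)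
    obtain ⟨ξ', hξ'⟩ := (isCompact_Icc.inter_right (I.isClosed_coversAt x₁ x₂ m)).exists_isGreatest
      ⟨ξ + ε, hmem, hm⟩
    have hle : ξ + ε ≤ ξ' := hξ'.2 ⟨hmem, hm⟩
    have := hmax ξ' (SafeUpTo.step m hξ hlt hm (fun m' h h' => hmin m' h' h) hξ'
      (by linarith : ξ < ξ').ne')
    simp only [id] at this
    linarith

/-! ### Finiteness of the vertex set -/

theorem finite_setOf_norm_sub_eq {a a' : Plane} {r r' : ℝ} (h : a = a' → r ≠ r') :
    {x : Plane | ‖x - a‖ = r ∧ ‖x - a'‖ = r'}.Finite := by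
  by_cases ha : a = a'
  · subst ha
    refine Set.Finite.subset finite_empty ?_
    rintro x ⟨h₁, h₂⟩
    exact h rfl (h₁.symm.trans h₂)
  rcases Set.subsingleton_or_nontrivial {x : Plane | ‖x - a‖ = r ∧ ‖x - a'‖ = r'} with hs | hs
  · exact hs.finite
  · obtain ⟨p₁, ⟨h₁, h₁'⟩, p₂, ⟨h₂, h₂'⟩, hne⟩ := hs
    refine (Set.toFinite {p₁, p₂}).subset ?_
    rintro p ⟨hp, hp'⟩
    have : Fact (Module.finrank ℝ Plane = 2) := ⟨by simp⟩
    exact EuclideanGeometry.eq_of_dist_eq_of_dist_eq_of_finrank_eq_two this.out (r₁ := r)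
      (r₂ := r') ha hne (by rwa [dist_eq_norm]) (by rwa [dist_eq_norm]) (by rwa [dist_eq_norm])
      (by rwa [dist_eq_norm]) (by rwa [dist_eq_norm]) (by rwa [dist_eq_norm])

/-- By `disc_ne`, concentric boundary circles have different radii and do not meet; circles with
different centres meet in at most two points. -/
theorem finite_Vin : I.Vin.Finite := by
  have : I.Vin ⊆ ⋃ m, ⋃ m', ⋃ (_ : m < m'),
      {x : Plane | ‖x - I.a m‖ = I.radius m ∧ ‖x - I.a m'‖ = I.radius m'} := by
    rintro x ⟨m, m', h, -, h₁, h₂⟩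
    simp only [mem_iUnion]
    exact ⟨m, m', h, h₁, h₂⟩
  refine Set.Finite.subset ?_ this
  refine finite_iUnion fun m => finite_iUnion fun m' => finite_iUnion fun h => ?_
  refine finite_setOf_norm_sub_eq fun ha hr => I.disc_ne m m' h.ne ha ?_
  simpa [radius] using hr

instance : Finite (Node N) := by
  have : Function.Surjective
      (fun o : Option (Option (Fin N)) => match o with
        | none => Node.start
        | some none => Node.goal
        | some (some n) => Node.cs n) := by
    rintro (n | _ | _)
    exacts [⟨some (some n), rfl⟩, ⟨none, rfl⟩, ⟨some none, rfl⟩]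
  exact Finite.of_surjective _ this

theorem finite_Vall : I.Vall.Finite := (finite_range _).union I.finite_Vin

/-- For all small steps, the outage tests of all pairs of vertices are correct. -/
theorem eventually_survives_iff :
    ∀ᶠ ε in 𝓝[>] (0 : ℝ), ∀ x y, I.Survives ε x y ↔
      x ∈ I.Vall ∧ y ∈ I.Vall ∧ x ≠ y ∧ segment ℝ x y ⊆ I.coverage := by
  have h : ∀ᶠ ε in 𝓝[>] (0 : ℝ), ∀ x ∈ I.Vall, ∀ y ∈ I.Vall,
      (I.NoOutage ε x y ↔ segment ℝ x y ⊆ I.coverage) := by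
    rw [eventually_all_finite I.finite_Vall]
    intro x _
    rw [eventually_all_finite I.finite_Vall]
    exact fun y _ => I.eventually_noOutage_iff x y
  filter_upwards [h] with ε h x y
  constructor
  · rintro ⟨hx, hy, hne, h' | h'⟩
    · exact ⟨hx, hy, hne, (h x hx y hy).1 h'⟩
    · exact ⟨hx, hy, hne, segment_symm ℝ x y ▸ (h y hy x hx).1 h'⟩
  · rintro ⟨hx, hy, hne, h'⟩
    exact ⟨hx, hy, hne, Or.inl ((h x hx y hy).2 h')⟩

end Mission

namespace Mission

open Set Filter Topology Metric

variable {M N : ℕ} (I : Mission M N)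

/-! ### Shortest paths within the coverage map -/

/-- Both points lie in the coverage disc of one BS. -/
def SameDisc (x y : Plane) : Prop := ∃ m, x ∈ I.disc m ∧ y ∈ I.disc m

/-- Different points that are joined by a segment within the coverage map. -/
def Visible (x y : Plane) : Prop := x ≠ y ∧ segment ℝ x y ⊆ I.coverage

variable {I} in
theorem SameDisc.symm {x y : Plane} (h : I.SameDisc x y) : I.SameDisc y x :=
  let ⟨m, hx, hy⟩ := h
  ⟨m, hy, hx⟩

variable {I} in
theorem SameDisc.segment_subset {x y : Plane} (h : I.SameDisc x y) :
    segment ℝ x y ⊆ I.coverage := by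
  obtain ⟨m, hx, hy⟩ := h
  exact ((I.convex_disc m).segment_subset hx hy).trans (subset_iUnion I.disc m)

theorem pathLength_cons_cons (x y : Plane) (l : List Plane) :
    pathLength (x :: y :: l) = ‖x - y‖ + pathLength (y :: l) := rfl

theorem pathLength_singleton (x : Plane) : pathLength [x] = 0 := rfl

theorem pathLength_append_cons (l₁ l₂ : List Plane) (a : Plane) :
    pathLength (l₁ ++ a :: l₂) = pathLength (l₁ ++ [a]) + pathLength (a :: l₂) :=
  aggWeight_append_cons l₁ l₂ a

theorem pathLength_nonneg (l : List Plane) : 0 ≤ pathLength l :=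
  aggWeight_nonneg (fun _ _ => norm_nonneg _) l

theorem isClosed_sameDisc : IsClosed {q : Plane × Plane | I.SameDisc q.1 q.2} := by
  have : {q : Plane × Plane | I.SameDisc q.1 q.2} = ⋃ m, I.disc m ×ˢ I.disc m := by
    ext; simp [SameDisc]
  rw [this]
  exact isClosed_iUnion_of_finite fun m => (I.isClosed_disc m).prod (I.isClosed_disc m)

/-- The head of the chain is a variable too, so that the induction on `k` can turn the first inner
point into the head of the remaining chain. -/
theorem isClosed_chain (y : Plane) (k : ℕ) : IsClosed {q : Plane × (Fin k → Plane) |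
    List.IsChain I.SameDisc (q.1 :: (List.ofFn q.2 ++ [y]))} := by
  induction k with
  | zero =>
    simp only [List.ofFn_zero, List.nil_append, List.isChain_pair]
    exact I.isClosed_sameDisc.preimage (f := fun q : Plane × (Fin 0 → Plane) => (q.1, y))
      (by fun_prop)
  | succ k ih =>
    simp only [List.ofFn_succ, List.cons_append, List.isChain_cons_cons]
    have hc : Continuous fun q : Plane × (Fin (k + 1) → Plane) =>
        ((q.2 0, fun i => q.2 i.succ) : Plane × (Fin k → Plane)) := by fun_prop
    exact (I.isClosed_sameDisc.preimage
      (f := fun q : Plane × (Fin (k + 1) → Plane) => (q.1, q.2 0)) (by fun_prop)).inter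
      (ih.preimage hc)

theorem continuous_pathLength (y : Plane) (k : ℕ) :
    Continuous fun q : Plane × (Fin k → Plane) => pathLength (q.1 :: (List.ofFn q.2 ++ [y])) := by
  induction k with
  | zero =>
    simp only [List.ofFn_zero, List.nil_append, pathLength_cons_cons, pathLength_singleton]
    fun_prop
  | succ k ih =>
    simp only [List.ofFn_succ, List.cons_append, pathLength_cons_cons]
    have hc : Continuous fun q : Plane × (Fin (k + 1) → Plane) =>
        ((q.2 0, fun i => q.2 i.succ) : Plane × (Fin k → Plane)) := by fun_prop
    exact (by fun_prop : Continuous fun q : Plane × (Fin (k + 1) → Plane) => ‖q.1 - q.2 0‖).add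
      (ih.comp hc)

theorem mem_coverage_of_chain {y : Plane} {l : List Plane} {x : Plane}
    (h : List.IsChain I.SameDisc (x :: (l ++ [y]))) : ∀ z ∈ l, z ∈ I.coverage := by
  induction l generalizing x with
  | nil => simp
  | cons a l ih =>
    rw [List.cons_append, List.isChain_cons_cons] at h
    intro z hz
    rcases List.mem_cons.1 hz with rfl | hz
    · obtain ⟨m, -, hm⟩ := h.1
      exact mem_iUnion.2 ⟨m, hm⟩
    · exact ih h.2 z hz

/-- Among the chains of a given number of points there is a shortest one. -/
theorem exists_shortest_chain {x y : Plane} {Z : List Plane}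
    (hZ : IsVisitingSeq I.SameDisc x y Z) :
    ∃ Z₀, IsVisitingSeq I.SameDisc x y Z₀ ∧ Z₀.length = Z.length ∧
      ∀ Z', IsVisitingSeq I.SameDisc x y Z' → Z'.length = Z.length →
        pathLength Z₀ ≤ pathLength Z' := by
  have hform : ∀ Z', IsVisitingSeq I.SameDisc x y Z' → Z'.length ≠ 1 →
      ∃ l, Z' = x :: (l ++ [y]) := by
    intro Z' hZ' hlen
    obtain ⟨l, rfl⟩ := hZ'.exists_eq_cons
    have hl : l ≠ [] := by rintro rfl; simp at hlen
    refine ⟨l.dropLast, ?_⟩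
    have h := hZ'.2.2
    rw [List.getLast?_cons_of_ne_nil hl, List.getLast?_eq_getLast_of_ne_nil hl] at h
    rw [← Option.some.inj h, List.dropLast_append_getLast hl]
  by_cases h1 : Z.length = 1
  · refine ⟨Z, hZ, rfl, fun Z' hZ' hlen => ?_⟩
    obtain ⟨z, rfl⟩ := List.length_eq_one_iff.1 h1
    exact (pathLength_singleton z).trans_le (pathLength_nonneg _)
  obtain ⟨l, hl⟩ := hform Z hZ h1
  set k := l.length with hk
  -- The chains with `k` inner points form a closed subset of a power of the compact coverage map;
  -- inner points are covered because each shares a disc with its predecessor.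
  set S : Set (Fin k → Plane) := univ.pi (fun _ => I.coverage) ∩
    {p | List.IsChain I.SameDisc (x :: (List.ofFn p ++ [y]))} with hS
  have hScomp : IsCompact S := by
    refine (isCompact_univ_pi fun _ => I.isCompact_coverage).inter_right ?_
    exact (I.isClosed_chain y k).preimage (f := fun p : Fin k → Plane => (x, p)) (by fun_prop)
  have hmem : ∀ Z', IsVisitingSeq I.SameDisc x y Z' → Z'.length = Z.length →
      ∃ p ∈ S, Z' = x :: (List.ofFn p ++ [y]) := by
    intro Z' hZ' hlen
    obtain ⟨l', rfl⟩ := hform Z' hZ' (hlen ▸ h1)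
    have hlk : l'.length = k := by
      rw [hl] at hlen
      simpa [hk] using hlen
    clear_value k
    subst hlk
    refine ⟨l'.get, ⟨fun i _ => I.mem_coverage_of_chain hZ'.1 _ (List.get_mem _ _), ?_⟩, ?_⟩
    · simp only [mem_ofPred_eq, List.ofFn_get]
      exact hZ'.1
    · rw [List.ofFn_get]
  have hcont : Continuous fun p : Fin k → Plane => pathLength (x :: (List.ofFn p ++ [y])) :=
    (continuous_pathLength y k).comp (by fun_prop : Continuous fun p : Fin k → Plane => (x, p))
  obtain ⟨p₀, hp₀, -⟩ := hmem Z hZ rfl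
  obtain ⟨p, hp, hmin⟩ := hScomp.exists_isMinOn ⟨p₀, hp₀⟩ hcont.continuousOn
  refine ⟨x :: (List.ofFn p ++ [y]), ⟨hp.2, by simp, ?_⟩, ?_, ?_⟩
  · rw [← List.cons_append, List.getLast?_append]
    simp
  · rw [hl]
    simp [hk]
  · intro Z' hZ' hlen
    obtain ⟨p', hp', rfl⟩ := hmem Z' hZ' hlen
    exact hmin hp'

/-! ### Shortest chains bend only at intersections of boundaries -/

/-- As `p` is interior to the disc `m'`, a point `z` slightly nearer to `a` on the segment from `p`
to `a` is still in both discs. Minimality at `p` then gives equality in the triangle inequality for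
`z`, `p`, `b`, so the path is straight at `p`. -/
theorem wbtw_of_forall_le {m m' : Fin M} {a p b : Plane} (hne : a ≠ p) (ha : a ∈ I.disc m)
    (hp : p ∈ I.disc m) (hp' : ‖p - I.a m'‖ < I.radius m')
    (hmin : ∀ z, z ∈ I.disc m → z ∈ I.disc m' → dist a p + dist p b ≤ dist a z + dist z b) :
    Wbtw ℝ a p b := by
  have hnear : ∀ᶠ t in 𝓝[>] (0 : ℝ), AffineMap.lineMap p a t ∈ I.disc m' := by
    have hc : Continuous (AffineMap.lineMap p a : ℝ → Plane) := AffineMap.lineMap_continuous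
    have : ∀ᶠ t in 𝓝 (0 : ℝ), AffineMap.lineMap p a t ∈ ball (I.a m') (I.radius m') := by
      refine hc.continuousAt.eventually (isOpen_ball.mem_nhds ?_)
      simpa [dist_eq_norm] using hp'
    exact (this.filter_mono nhdsWithin_le_nhds).mono fun t ht => ball_subset_closedBall ht
  obtain ⟨t, ht, ht0, ht1⟩ := (hnear.and (Ioc_mem_nhdsGT zero_lt_one)).exists
  set z : Plane := AffineMap.lineMap p a t with hz
  have hzw : Wbtw ℝ p z a := ⟨t, ⟨ht0.le, ht1⟩, rfl⟩
  have hzm : z ∈ I.disc m :=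
    (I.convex_disc m).segment_subset hp ha (mem_segment_iff_wbtw.2 hzw)
  have hzp : z ≠ p := by
    intro h
    rw [hz, AffineMap.lineMap_eq_left_iff] at h
    exact h.elim (fun h => hne h.symm) ht0.ne'
  have h₁ := hmin z hzm ht
  have h₂ : dist a z + dist z p = dist a p := dist_add_dist_eq_iff.2 hzw.symm
  have h₃ : dist z p + dist p b = dist z b :=
    le_antisymm (by linarith) (dist_triangle _ _ _)
  exact hzw.symm.trans_expand_right (dist_add_dist_eq_iff.1 h₃) hzp

theorem segment_subset_union_of_wbtw {x p b : Plane} (h : Wbtw ℝ x p b) :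
    segment ℝ x b ⊆ segment ℝ x p ∪ segment ℝ p b := by
  intro z hz
  obtain ⟨r, hr, rfl⟩ := h
  obtain ⟨s, hs, rfl⟩ := mem_segment_iff_wbtw.1 hz
  rcases le_total s r with hsr | hsr
  · refine Or.inl (mem_segment_iff_wbtw.2 ?_)
    have : Wbtw ℝ 0 s r := mem_segment_iff_wbtw.1 (by rw [segment_eq_Icc hr.1]; exact ⟨hs.1, hsr⟩)
    simpa using this.map (AffineMap.lineMap x b)
  · refine Or.inr (mem_segment_iff_wbtw.2 ?_)
    have : Wbtw ℝ r s 1 := mem_segment_iff_wbtw.1 (by rw [segment_eq_Icc hr.2]; exact ⟨hsr, hs.2⟩)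
    simpa using this.map (AffineMap.lineMap x b)

variable {I} in
theorem Visible.trans_of_wbtw {x p b : Plane} (h₁ : I.Visible x p) (h₂ : I.Visible p b)
    (h : Wbtw ℝ x p b) : I.Visible x b := by
  refine ⟨?_, (segment_subset_union_of_wbtw h).trans (union_subset h₁.2 h₂.2)⟩
  rintro rfl
  exact h₁.1 ((wbtw_self_iff ℝ).1 h).symm

/-- A polygon within the coverage map can be freed from the vertices that are neither in `Vin` nor
turning points. -/
theorem exists_polygon_of_straight {y : Plane} (n : ℕ) : ∀ {x : Plane} {Z : List Plane},
    Z.length ≤ n → IsVisitingSeq I.Visible x y Z →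
    (∀ l₁ a p b l₂, Z = l₁ ++ a :: p :: b :: l₂ → p ∈ I.Vin ∨ Wbtw ℝ a p b) →
    ∃ Z', IsVisitingSeq I.Visible x y Z' ∧ (∀ z ∈ Z', z = x ∨ z = y ∨ z ∈ I.Vin) ∧
      pathLength Z' ≤ pathLength Z := by
  induction n with
  | zero =>
    intro x Z hn hZ
    obtain ⟨l, rfl⟩ := hZ.exists_eq_cons
    simp at hn
  | succ n ih =>
    intro x Z hn hZ htri
    obtain ⟨l, rfl⟩ := hZ.exists_eq_cons
    match l with
    | [] => exact ⟨[x], hZ, by simp, le_rfl⟩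
    | [p] =>
      refine ⟨[x, p], hZ, ?_, le_rfl⟩
      have : p = y := by simpa [IsVisitingSeq] using hZ.2.2
      simp [this]
    | p :: b :: l =>
      obtain ⟨hxp, hp⟩ := isVisitingSeq_cons_cons.1 hZ
      obtain ⟨hpb, hb⟩ := isVisitingSeq_cons_cons.1 hp
      -- A vertex in `Vin` is kept and becomes the start of the recursion; any other one is straight
      -- and is deleted.
      rcases htri [] x p b l rfl with hV | hw
      · obtain ⟨Z', hZ', hmem, hlen⟩ := ih (by simpa using hn) hp
          fun l₁ a q c l₂ h => htri (x :: l₁) a q c l₂ (by rw [h]; rfl)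
        refine ⟨x :: Z', hZ'.cons hxp, ?_, ?_⟩
        · intro z hz
          rcases List.mem_cons.1 hz with rfl | hz
          · exact Or.inl rfl
          · rcases hmem z hz with rfl | h
            exacts [Or.inr (Or.inr hV), Or.inr h]
        · obtain ⟨l', rfl⟩ := hZ'.exists_eq_cons
          rw [pathLength_cons_cons, pathLength_cons_cons]
          gcongr
      · obtain ⟨Z', hZ', hmem, hlen⟩ := ih (Z := x :: b :: l) (by simpa using hn)
          (isVisitingSeq_cons_cons.2 ⟨hxp.trans_of_wbtw hpb hw, hb⟩) (by
            intro l₁ a q c l₂ h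
            cases l₁ with
            | nil =>
              simp only [List.nil_append, List.cons.injEq] at h
              obtain ⟨rfl, rfl, rfl⟩ := h
              -- Deleting `p` changes the predecessor of `b`. Straightness at `b` survives because
              -- `x`, `p`, `b` are in line and `p ≠ b`.
              refine (htri [x] p b c l₂ rfl).imp_right fun h' => ?_
              exact hw.trans_expand_right h' hpb.1
            | cons d l₁ =>
              simp only [List.cons_append, List.cons.injEq] at h
              obtain ⟨rfl, h⟩ := h
              exact htri (x :: p :: l₁) a q c l₂ (by rw [h]; rfl))
        refine ⟨Z', hZ', hmem, hlen.trans ?_⟩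
        simp only [pathLength_cons_cons]
        have := norm_sub_le_norm_sub_add_norm_sub x p b
        linarith

theorem mem_Vin_of_norm_eq {m m' : Fin M} {p : Plane} (hne : m ≠ m')
    (h : ‖p - I.a m‖ = I.radius m) (h' : ‖p - I.a m'‖ = I.radius m') : p ∈ I.Vin := by
  wlog hlt : m < m' generalizing m m'
  · exact this hne.symm h' h (lt_of_le_of_ne (not_lt.1 hlt) hne.symm)
  refine ⟨m, m', hlt, ?_, h, h'⟩
  rw [← h, ← h', norm_sub_rev p (I.a m)]
  exact norm_sub_le_norm_sub_add_norm_sub _ _ _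

/-- Any chain of points, each in a common disc with the next, is at least as long as some polygon
within the coverage map all of whose inner vertices are intersection points of coverage
boundaries. -/
theorem exists_polygon {x y : Plane} (n : ℕ) : ∀ {Z : List Plane}, Z.length ≤ n →
    IsVisitingSeq I.SameDisc x y Z →
    ∃ Z', IsVisitingSeq I.Visible x y Z' ∧ (∀ z ∈ Z', z = x ∨ z = y ∨ z ∈ I.Vin) ∧
      pathLength Z' ≤ pathLength Z := by
  induction n with
  | zero =>
    intro Z hn hZ
    obtain ⟨l, rfl⟩ := hZ.exists_eq_cons
    simp at hn
  | succ n ih =>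
    intro Z hn hZ
    obtain ⟨Z₀, hZ₀, hlen, hmin⟩ := I.exists_shortest_chain hZ
    have hle := hmin Z hZ rfl
    -- A repeated point, or a point whose neighbours share a disc, can be dropped without adding
    -- length, and the induction applies to the shorter chain.
    by_cases hdup : ∃ l₁ a l₂, Z₀ = l₁ ++ a :: a :: l₂
    · obtain ⟨l₁, a, l₂, rfl⟩ := hdup
      obtain ⟨hc, hh, hg⟩ := hZ₀
      rw [List.isChain_append_cons_cons] at hc
      obtain ⟨Z', h₁, h₂, h₃⟩ := ih (Z := l₁ ++ a :: l₂)
        (by simp only [List.length_append, List.length_cons] at hlen ⊢; omega)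
        ⟨List.isChain_split.2 ⟨hc.1, hc.2.2⟩, by simpa using hh, by simpa using hg⟩
      refine ⟨Z', h₁, h₂, (h₃.trans ?_).trans hle⟩
      rw [pathLength_append_cons, pathLength_append_cons l₁ (a :: l₂), pathLength_cons_cons]
      simp
    by_cases hskip : ∃ l₁ a p b l₂, Z₀ = l₁ ++ a :: p :: b :: l₂ ∧ I.SameDisc a b
    · obtain ⟨l₁, a, p, b, l₂, rfl, hab⟩ := hskip
      obtain ⟨hc, hh, hg⟩ := hZ₀
      simp only [List.isChain_append_cons_cons, List.isChain_cons_cons] at hc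
      obtain ⟨Z', h₁, h₂, h₃⟩ := ih (Z := l₁ ++ a :: b :: l₂)
        (by simp only [List.length_append, List.length_cons] at hlen ⊢; omega)
        ⟨List.isChain_append_cons_cons.2 ⟨hc.1, hab, hc.2.2.2⟩, by simpa using hh,
          by simpa using hg⟩
      refine ⟨Z', h₁, h₂, (h₃.trans ?_).trans hle⟩
      rw [pathLength_append_cons, pathLength_append_cons l₁ (p :: b :: l₂)]
      simp only [pathLength_cons_cons]
      have := norm_sub_le_norm_sub_add_norm_sub a p b
      linarith
    have hvis : IsVisitingSeq I.Visible x y Z₀ := by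
      refine ⟨List.isChain_iff_forall_rel_of_append_cons_cons.2 fun a b l₁ l₂ h => ⟨?_, ?_⟩,
        hZ₀.2⟩
      · rintro rfl
        exact hdup ⟨l₁, a, l₂, h⟩
      · exact (List.isChain_iff_forall_rel_of_append_cons_cons.1 hZ₀.1 h).segment_subset
    obtain ⟨Z', h₁, h₂, h₃⟩ := I.exists_polygon_of_straight Z₀.length le_rfl hvis (by
      rintro l₁ a p b l₂ rfl
      obtain ⟨hc, hh, hg⟩ := hZ₀
      simp only [List.isChain_append_cons_cons, List.isChain_cons_cons] at hc
      obtain ⟨hc₁, ⟨m, ham, hpm⟩, ⟨m', hpm', hbm'⟩, hc₂⟩ := hc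
      have hap : a ≠ p := by
        rintro rfl
        exact hdup ⟨l₁, a, b :: l₂, rfl⟩
      have hpb : p ≠ b := by
        rintro rfl
        exact hdup ⟨l₁ ++ [a], p, l₂, by simp⟩
      have hmm : m ≠ m' := by
        rintro rfl
        exact hskip ⟨l₁, a, p, b, l₂, rfl, m, ham, hbm'⟩
      -- Exchanging `p` for any `z` in both discs gives a chain with equally many points, so `p`
      -- minimises the detour between `a` and `b` over the intersection of the discs.
      have hloc : ∀ z, z ∈ I.disc m → z ∈ I.disc m' →
          dist a p + dist p b ≤ dist a z + dist z b := by
        intro z hz hz'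
        have := hmin (l₁ ++ a :: z :: b :: l₂)
          ⟨by
            simp only [List.isChain_append_cons_cons, List.isChain_cons_cons]
            exact ⟨hc₁, ⟨m, ham, hz⟩, ⟨m', hz', hbm'⟩, hc₂⟩, by simpa using hh, by simpa using hg⟩
          (by rw [← hlen]; simp)
        rw [pathLength_append_cons, pathLength_append_cons l₁ (z :: b :: l₂)] at this
        simp only [pathLength_cons_cons] at this
        simp only [dist_eq_norm]
        linarith
      -- If `p` is interior to either disc, the path is straight at `p`; otherwise `p` lies on both
      -- boundary circles.
      by_cases h' : ‖p - I.a m'‖ < I.radius m'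
      · exact Or.inr (I.wbtw_of_forall_le hap ham hpm h' hloc)
      by_cases h : ‖p - I.a m‖ < I.radius m
      · refine Or.inr (I.wbtw_of_forall_le hpb.symm hbm' hpm' h fun z hz hz' => ?_).symm
        rw [dist_comm b p, dist_comm p a, dist_comm b z, dist_comm z a, add_comm,
          add_comm (dist z b)]
        exact hloc z hz' hz
      · rw [disc, mem_closedBall, dist_eq_norm] at hpm hpm'
        exact Or.inl (I.mem_Vin_of_norm_eq hmm (le_antisymm hpm (not_lt.1 h))
          (le_antisymm hpm' (not_lt.1 h'))))
    exact ⟨Z', h₁, h₂, h₃.trans hle⟩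

end Mission

namespace Mission

open Set Filter Topology Metric MeasureTheory

variable {M N : ℕ} (I : Mission M N)

/-! ### Power, energy per unit distance, and battery budget -/

/-- The energy that may be consumed between two battery replacements. -/
noncomputable def budget : ℝ := I.gam / I.rsafe * I.capacity

/-- The energy per unit distance at constant speed `v`. -/
noncomputable def cost (v : ℝ) : ℝ := I.power v / (I.eta * v)

/-- The least energy per unit distance. -/
noncomputable def minCost : ℝ := I.speeds.inf' I.speeds_nonempty I.cost

theorem power_pos {v : ℝ} (hv : 0 ≤ v) : 0 < I.power v := by
  have := I.P₁_pos
  have := I.P₂_pos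
  have := I.SFP_pos
  have := I.rho_pos
  have : 0 ≤ I.P₂ I.w := I.P₂_pos.le
  unfold power
  positivity

theorem continuous_power : Continuous I.power := by
  unfold power
  fun_prop

theorem cost_pos {v : ℝ} (hv : 0 < v) : 0 < I.cost v :=
  div_pos (I.power_pos hv.le) (mul_pos I.eta_pos hv)

theorem minCost_pos : 0 < I.minCost :=
  (Finset.lt_inf'_iff _).2 fun v hv => I.cost_pos (I.speeds_pos v hv)

theorem minCost_le {v : ℝ} (hv : v ∈ I.speeds) : I.minCost ≤ I.cost v :=
  Finset.inf'_le _ hv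

theorem exists_cost_eq_minCost : ∃ v ∈ I.speeds, I.minCost = I.cost v :=
  Finset.exists_mem_eq_inf' _ _

theorem cost_mul {v : ℝ} (hv : 0 < v) (l : ℝ) : I.cost v * l = l / v * (I.power v / I.eta) := by
  have := I.eta_pos.ne'
  have := hv.ne'
  unfold cost
  field_simp

theorem budget_pos : 0 < I.budget := by
  have := I.gam_pos
  have : 0 < I.rsafe := one_pos.trans I.rsafe_gt
  have := I.epsBatt_pos
  have := I.w₂_pos
  unfold budget capacity
  positivity

/-- The flight range is the budget divided by the cost per unit distance. In this form affordability
is monotone in the cost, so a cheapest speed can fly whatever any speed can fly. -/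
theorem le_dfly_iff {v : ℝ} (hv : 0 < v) (l : ℝ) : l ≤ I.dfly v ↔ I.cost v * l ≤ I.budget := by
  have := I.eta_pos
  have : 0 < I.rsafe := one_pos.trans I.rsafe_gt
  have := I.power_pos hv.le
  have hd : I.dfly v = I.budget / I.cost v := by
    unfold dfly budget cost
    field_simp
  rw [hd, le_div_iff₀ (I.cost_pos hv), mul_comm]

theorem minCost_mul_le_power {v : ℝ} (hv : v ∈ I.speedSet) :
    I.minCost * v ≤ I.power v / I.eta := by
  rcases hv with rfl | hv
  · rw [mul_zero]
    exact (div_pos (I.power_pos le_rfl) I.eta_pos).le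
  · have hpos := I.speeds_pos v hv
    refine (mul_le_mul_of_nonneg_right (I.minCost_le hv) hpos.le).trans_eq ?_
    rw [I.cost_mul hpos, div_self hpos.ne', one_mul]

/-! ### The energy consumption along a feasible trajectory -/

/-- The rate of energy consumption. -/
noncomputable def rate (p : Trajectory N) : ℝ → ℝ :=
  indicator {t | t ∈ Icc 0 p.T ∧ p.ψ t = none} fun t => I.power ‖deriv p.u t‖ / I.eta

variable {I} {p : Trajectory N}

theorem rate_nonneg (t : ℝ) : 0 ≤ I.rate p t :=
  indicator_nonneg (fun _ _ => (div_pos (I.power_pos (norm_nonneg _)) I.eta_pos).le) t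

theorem energyUsed_eq_integral_rate
    (hmeas : MeasurableSet {t | t ∈ Icc 0 p.T ∧ p.ψ t = none}) {s t : ℝ} (hs : 0 ≤ s)
    (hst : s ≤ t) (ht : t ≤ p.T) : I.energyUsed p s t = ∫ x in s..t, I.rate p x := by
  rw [intervalIntegral.integral_of_le hst, ← integral_Icc_eq_integral_Ioc, rate,
    setIntegral_indicator hmeas, energyUsed]
  congr 2
  ext x
  simp only [mem_ofPred_eq, mem_inter_iff, mem_Icc]
  constructor
  · rintro ⟨h, h'⟩
    exact ⟨h, ⟨hs.trans h.1, h.2.trans ht⟩, h'⟩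
  · rintro ⟨h, -, h'⟩
    exact ⟨h, h'⟩

theorem integrableOn_rate_of (hmeas : MeasurableSet {t | t ∈ Icc 0 p.T ∧ p.ψ t = none})
    (hspeed : ∀ᵐ t, t ∈ Icc 0 p.T → DifferentiableAt ℝ p.u t ∧ ‖deriv p.u t‖ ∈ I.speedSet) :
    IntegrableOn (I.rate p) (Icc 0 p.T) := by
  have hm : Measurable (I.rate p) := by
    refine Measurable.indicator ?_ hmeas
    exact (I.continuous_power.measurable.comp (measurable_deriv p.u).norm).div_const _
  obtain ⟨C, hC⟩ := ((insert (0 : ℝ) I.speeds).image fun v => I.power v / I.eta).bddAbove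
  refine Measure.integrableOn_of_bounded (M := max C 0) (by simp) hm.aestronglyMeasurable ?_
  rw [ae_restrict_iff' measurableSet_Icc]
  filter_upwards [hspeed] with t ht hI
  obtain ⟨-, hv⟩ := ht hI
  rw [Real.norm_of_nonneg (rate_nonneg t), rate]
  by_cases hψ : t ∈ {t | t ∈ Icc 0 p.T ∧ p.ψ t = none}
  · rw [indicator_of_mem hψ]
    refine le_max_of_le_left (hC ?_)
    simp only [Finset.coe_image, Finset.coe_insert]
    exact ⟨_, hv, rfl⟩
  · rw [indicator_of_notMem hψ]
    exact le_max_right _ _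

namespace IsFeasible

variable (hp : I.IsFeasible p)

include hp

theorem continuousOn : ContinuousOn p.u (Icc 0 p.T) :=
  let ⟨_, hK⟩ := hp.lipschitz
  hK.continuousOn

theorem integrableOn_rate : IntegrableOn (I.rate p) (Icc 0 p.T) :=
  integrableOn_rate_of hp.measurable_airborne hp.speed

theorem intervalIntegrable_rate {s t : ℝ} (hs : 0 ≤ s) (hst : s ≤ t) (ht : t ≤ p.T) :
    IntervalIntegrable (I.rate p) volume s t := by
  rw [intervalIntegrable_iff_integrableOn_Icc_of_le hst]
  exact hp.integrableOn_rate.mono_set (Icc_subset_Icc hs ht)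

theorem energyUsed_eq {s t : ℝ} (hs : 0 ≤ s) (hst : s ≤ t) (ht : t ≤ p.T) :
    I.energyUsed p s t = ∫ x in s..t, I.rate p x :=
  energyUsed_eq_integral_rate hp.measurable_airborne hs hst ht

theorem energyUsed_add {r s t : ℝ} (hr : 0 ≤ r) (hrs : r ≤ s) (hst : s ≤ t) (ht : t ≤ p.T) :
    I.energyUsed p r s + I.energyUsed p s t = I.energyUsed p r t := by
  rw [hp.energyUsed_eq hr hrs (hst.trans ht), hp.energyUsed_eq (hr.trans hrs) hst ht,
    hp.energyUsed_eq hr (hrs.trans hst) ht]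
  exact intervalIntegral.integral_add_adjacent_intervals
    (hp.intervalIntegrable_rate hr hrs (hst.trans ht))
    (hp.intervalIntegrable_rate (hr.trans hrs) hst ht)

theorem energyUsed_nonneg {s t : ℝ} (hs : 0 ≤ s) (hst : s ≤ t) (ht : t ≤ p.T) :
    0 ≤ I.energyUsed p s t := by
  rw [hp.energyUsed_eq hs hst ht]
  exact intervalIntegral.integral_nonneg hst fun _ _ => rate_nonneg _

theorem exists_eq_c_of_ne_none {t : ℝ} (ht : t ∈ Icc 0 p.T) (h : p.ψ t ≠ none) :
    ∃ n, p.u t = I.c n := by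
  by_contra! h'
  exact h (hp.airborne t ht h')

omit hp in
-- A point isolated in the level set is in particular isolated from the right within it, and a set
-- of reals has only countably many such points.
theorem countable_setOf_isolated {E : Type*} {f : ℝ → E} (c : E) :
    {t | f t = c ∧ ¬ ∃ᶠ y in 𝓝[≠] t, f y = c}.Countable := by
  refine (countable_setOfPred_isolated_right_within (s := {t | f t = c})).mono ?_
  rintro t ⟨ht, hfreq⟩
  refine ⟨ht, ?_⟩
  rw [not_frequently] at hfreq
  rw [← empty_mem_iff_bot]
  have h₁ : ∀ᶠ y in 𝓝[{t | f t = c} ∩ Ioi t] t, ¬ f y = c :=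
    hfreq.filter_mono (nhdsWithin_mono _ fun y hy => (ne_of_gt hy.2 : y ≠ t))
  filter_upwards [h₁, self_mem_nhdsWithin] with y hy hy'
  exact hy hy'.1

/-- The energy consumption pays for the distance covered. -/
theorem minCost_mul_norm_le_rate :
    ∀ᵐ t, t ∈ Icc 0 p.T → I.minCost * ‖deriv p.u t‖ ≤ I.rate p t := by
  -- During stays the rate is zero, so the derivative must vanish there as well. Every stay is at
  -- some `c n`, and apart from countably many times `u` takes the value `c n` arbitrarily near by,
  -- which makes the derivative `0`.
  have hiso : ∀ᵐ t, ∀ n, ¬ (p.u t = I.c n ∧ ¬ ∃ᶠ y in 𝓝[≠] t, p.u y = I.c n) := by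
    rw [ae_all_iff]
    intro n
    exact measure_eq_zero_iff_ae_notMem.1 ((countable_setOf_isolated (I.c n)).measure_zero volume)
  filter_upwards [hp.speed, hiso] with t hs hiso ht
  obtain ⟨-, hv⟩ := hs ht
  by_cases hψ : p.ψ t = none
  · rw [rate, indicator_of_mem (show t ∈ {t | t ∈ Icc 0 p.T ∧ p.ψ t = none} from ⟨ht, hψ⟩)]
    exact I.minCost_mul_le_power hv
  · obtain ⟨n, hn⟩ := hp.exists_eq_c_of_ne_none ht hψ
    have hfreq : ∃ᶠ y in 𝓝[≠] t, p.u y = I.c n := by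
      by_contra h
      exact hiso n ⟨hn, h⟩
    rw [deriv_zero_of_frequently_const hfreq, norm_zero, mul_zero]
    exact rate_nonneg t

/-- Projected onto the displacement `w`, the path is a real Lipschitz function that increases by
`‖w‖ ^ 2`. This is the integral of its derivative, which is at most `‖w‖` times the speed, and the
speed is paid for by the rate. -/
theorem minCost_mul_dist_le {s t : ℝ} (hs : 0 ≤ s) (hst : s ≤ t) (ht : t ≤ p.T) :
    I.minCost * ‖p.u s - p.u t‖ ≤ I.energyUsed p s t := by
  rw [norm_sub_rev, hp.energyUsed_eq hs hst ht]
  have hnn : 0 ≤ ∫ x in s..t, I.rate p x :=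
    intervalIntegral.integral_nonneg hst fun _ _ => rate_nonneg _
  set w := p.u t - p.u s with hw
  rcases (norm_nonneg w).eq_or_lt with h0 | hpos
  · rwa [← h0, mul_zero]
  obtain ⟨K, hK⟩ := hp.lipschitz
  have hsub : uIcc s t ⊆ Icc 0 p.T := by
    rw [uIcc_of_le hst]
    exact Icc_subset_Icc hs ht
  have hac : AbsolutelyContinuousOnInterval (fun x => inner ℝ w (p.u x)) s t :=
    ((innerSL ℝ w).lipschitz.comp_lipschitzOnWith
      (hK.mono hsub)).absolutelyContinuousOnInterval
  have hmono : ∫ x in s..t, I.minCost * deriv (fun x => inner ℝ w (p.u x)) x ≤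
      ∫ x in s..t, ‖w‖ * I.rate p x := by
    refine intervalIntegral.integral_mono_ae_restrict hst
      (hac.intervalIntegrable_deriv.const_mul _)
      ((hp.intervalIntegrable_rate hs hst ht).const_mul _) ?_
    rw [EventuallyLE, ae_restrict_iff' measurableSet_Icc]
    filter_upwards [hp.speed, hp.minCost_mul_norm_le_rate] with x hx hr hxI
    have hxT : x ∈ Icc 0 p.T := Icc_subset_Icc hs ht hxI
    have hd : HasDerivAt (fun x => inner ℝ w (p.u x)) (inner ℝ w (deriv p.u x)) x :=
      (innerSL ℝ w).hasFDerivAt.comp_hasDerivAt x (hx hxT).1.hasDerivAt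
    rw [hd.deriv]
    calc I.minCost * inner ℝ w (deriv p.u x)
        ≤ I.minCost * (‖w‖ * ‖deriv p.u x‖) := by
          gcongr
          · exact I.minCost_pos.le
          · exact real_inner_le_norm _ _
      _ = ‖w‖ * (I.minCost * ‖deriv p.u x‖) := by ring
      _ ≤ ‖w‖ * I.rate p x := by
          gcongr
          exact hr hxT
  rw [intervalIntegral.integral_const_mul, intervalIntegral.integral_const_mul,
    hac.integral_deriv_eq_sub, ← inner_sub_right, ← hw, real_inner_self_eq_norm_sq] at hmono
  refine le_of_mul_le_mul_left ?_ hpos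
  calc ‖w‖ * (I.minCost * ‖w‖) = I.minCost * ‖w‖ ^ 2 := by ring
    _ ≤ _ := hmono

/-- Take a disc that contains the current position and jump to the last time in that disc.
Afterwards the path never returns to it, so one disc fewer is needed; hence the induction on the
number of discs. -/
theorem exists_discChain (n : ℕ) : ∀ (F : Finset (Fin M)), F.card ≤ n → ∀ {s t : ℝ}, 0 ≤ s →
    s ≤ t → t ≤ p.T → (∀ x ∈ Icc s t, ∃ m ∈ F, p.u x ∈ I.disc m) →
    ∃ Z, IsVisitingSeq I.SameDisc (p.u s) (p.u t) Z ∧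
      I.minCost * pathLength Z ≤ I.energyUsed p s t := by
  induction n with
  | zero =>
    intro F hF s t _ hst _ hcov
    obtain ⟨m, hm, -⟩ := hcov s (left_mem_Icc.2 hst)
    simp [Finset.card_eq_zero.1 (Nat.le_zero.1 hF)] at hm
  | succ n ih =>
    intro F hF s t hs hst ht hcov
    obtain ⟨m, hm, hsm⟩ := hcov s (left_mem_Icc.2 hst)
    have hcont : ContinuousOn p.u (Icc s t) := hp.continuousOn.mono (Icc_subset_Icc hs ht)
    obtain ⟨r, ⟨hrI, hrm⟩, hmax⟩ :=
      (isCompact_Icc.of_isClosed_subset (hcont.preimage_isClosed_of_isClosed isClosed_Icc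
        (I.isClosed_disc m)) inter_subset_left).exists_isGreatest
        ⟨s, left_mem_Icc.2 hst, hsm⟩
    have hstep : I.SameDisc (p.u s) (p.u r) := ⟨m, hsm, hrm⟩
    have hle := hp.minCost_mul_dist_le hs hrI.1 (hrI.2.trans ht)
    rcases hrI.2.eq_or_lt with rfl | hlt
    · refine ⟨[p.u s, p.u r], isVisitingSeq_singleton.cons hstep, ?_⟩
      rwa [pathLength_cons_cons, pathLength_singleton, add_zero]
    have hclosed : IsClosed (Icc r t ∩ p.u ⁻¹' ⋃ m' ∈ F.erase m, I.disc m') :=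
      (hcont.mono (Icc_subset_Icc_left hrI.1)).preimage_isClosed_of_isClosed isClosed_Icc
        ((F.erase m).finite_toSet.isClosed_biUnion fun m' _ => I.isClosed_disc m')
    have hIoc : Ioc r t ⊆ Icc r t ∩ p.u ⁻¹' ⋃ m' ∈ F.erase m, I.disc m' := by
      intro x hx
      have hxI : x ∈ Icc s t := ⟨hrI.1.trans hx.1.le, hx.2⟩
      obtain ⟨m', hm', hxm'⟩ := hcov x hxI
      refine ⟨Ioc_subset_Icc_self hx, mem_iUnion₂.2 ⟨m', Finset.mem_erase.2 ⟨?_, hm'⟩, hxm'⟩⟩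
      rintro rfl
      exact (not_le.2 hx.1) (hmax ⟨hxI, hxm'⟩)
    -- The other discs cover the path strictly after `r`; since they are closed, they cover it at
    -- `r` too.
    have hIcc := hclosed.closure_subset_iff.2 hIoc
    rw [closure_Ioc hlt.ne] at hIcc
    obtain ⟨Z, hZ, hlen⟩ := ih (F.erase m)
      (by rw [Finset.card_erase_of_mem hm]; omega) (hs.trans hrI.1) hrI.2 ht fun x hx => by
        obtain ⟨m', hm', h⟩ := mem_iUnion₂.1 (hIcc hx).2
        exact ⟨m', hm', h⟩
    refine ⟨p.u s :: Z, hZ.cons hstep, ?_⟩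
    obtain ⟨l, rfl⟩ := hZ.exists_eq_cons
    rw [pathLength_cons_cons, mul_add, ← hp.energyUsed_add hs hrI.1 hrI.2 ht]
    exact add_le_add hle hlen

/-- The energy consumption of a feasible trajectory is at least that of a flight along some polygon
within the coverage map whose inner vertices are intersection points of coverage boundaries. -/
theorem exists_polygon {s t : ℝ} (hs : 0 ≤ s) (hst : s ≤ t) (ht : t ≤ p.T) :
    ∃ Z, IsVisitingSeq I.Visible (p.u s) (p.u t) Z ∧
      (∀ z ∈ Z, z = p.u s ∨ z = p.u t ∨ z ∈ I.Vin) ∧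
      I.minCost * pathLength Z ≤ I.energyUsed p s t := by
  obtain ⟨Z, hZ, hlen⟩ := hp.exists_discChain _ Finset.univ le_rfl hs hst ht fun x hx => by
    obtain ⟨m, hm⟩ := mem_iUnion.1
      (I.covered_iff.1 (hp.connected x (Icc_subset_Icc hs ht hx)))
    exact ⟨m, Finset.mem_univ m, hm⟩
  obtain ⟨Z', h₁, h₂, h₃⟩ := I.exists_polygon _ le_rfl hZ
  exact ⟨Z', h₁, h₂, (mul_le_mul_of_nonneg_left h₃ I.minCost_pos.le).trans hlen⟩

end IsFeasible

end Mission

namespace Mission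

open Set Filter Topology Metric MeasureTheory

variable {M N : ℕ} (I : Mission M N)

/-! ### Flight plans -/

/-- Duration of a flight plan. -/
noncomputable def planTime (l : List (Phase N)) : ℝ := (l.map I.duration).sum

/-- Energy consumption of a phase. -/
noncomputable def phaseCost : Phase N → ℝ
  | Phase.fly x y v => I.cost v * ‖x - y‖
  | Phase.dock _ => 0

/-- Energy consumption of a flight plan. -/
noncomputable def planCost (l : List (Phase N)) : ℝ := (l.map I.phaseCost).sum

/-- Speed during a phase. -/
def phaseSpeed : Phase N → ℝ
  | Phase.fly _ _ v => v
  | Phase.dock _ => 0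

/-- Energy consumed by a flight plan up to time `t`. -/
noncomputable def planUsed : List (Phase N) → ℝ → ℝ
  | [], _ => 0
  | Phase.fly x y v :: l, t =>
      if t < ‖x - y‖ / v then t * (I.power v / I.eta)
      else I.cost v * ‖x - y‖ + planUsed l (t - ‖x - y‖ / v)
  | Phase.dock n :: l, t => if t ≤ I.tau n then 0 else planUsed l (t - I.tau n)

/-- The trajectory of a flight plan. -/
noncomputable def planTrajectory (l : List (Phase N)) : Trajectory N where
  T := I.planTime l
  u := I.planPos l
  ψ := I.planInd l

/-- `ValidPlan I f b x l`: the flight plan `l` starts in `x` and ends in the final point, remains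
within the coverage map, flies at admissible speeds, consumes at most `b` before the first battery
replacement and at most the budget between two replacements; the stays are not consecutive, and
`l` may start with a stay only if `f = true`. -/
inductive ValidPlan : Bool → ℝ → Plane → List (Phase N) → Prop
  | nil {f : Bool} {b : ℝ} : 0 ≤ b → I.uF ∈ I.coverage → ValidPlan f b I.uF []
  | fly {f : Bool} {b : ℝ} {x y : Plane} {v : ℝ} {l : List (Phase N)} : I.Visible x y →
      v ∈ I.speeds → ValidPlan true (b - I.cost v * ‖x - y‖) y l →
      ValidPlan f b x (Phase.fly x y v :: l)
  | dock {b : ℝ} {n : Fin N} {l : List (Phase N)} : 0 ≤ b → ValidPlan false I.budget (I.c n) l →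
      ValidPlan true b (I.c n) (Phase.dock n :: l)

theorem planTime_nil : I.planTime [] = 0 := rfl

theorem planTime_cons (ph : Phase N) (l : List (Phase N)) :
    I.planTime (ph :: l) = I.duration ph + I.planTime l := by
  simp [planTime]

theorem planTime_append (l₁ l₂ : List (Phase N)) :
    I.planTime (l₁ ++ l₂) = I.planTime l₁ + I.planTime l₂ := by
  simp [planTime]

theorem planCost_cons (ph : Phase N) (l : List (Phase N)) :
    I.planCost (ph :: l) = I.phaseCost ph + I.planCost l := by
  simp [planCost]

theorem planCost_append (l₁ l₂ : List (Phase N)) :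
    I.planCost (l₁ ++ l₂) = I.planCost l₁ + I.planCost l₂ := by
  simp [planCost]

theorem le_vmax {v : ℝ} (hv : v ∈ I.speeds) : v ≤ I.vmax := Finset.le_max' _ _ hv

theorem vmax_mem : I.vmax ∈ I.speeds := Finset.max'_mem _ _

theorem vmax_pos : 0 < I.vmax := I.speeds_pos _ I.vmax_mem

variable {I}

theorem planInd_eq_some {l : List (Phase N)} {t : ℝ} {n : Fin N} (h : I.planInd l t = some n) :
    I.planPos l t = I.c n := by
  induction l generalizing t with
  | nil => simp [planInd] at h
  | cons ph l ih =>
    cases ph with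
    | fly x y v =>
      simp only [planInd, planPos] at h ⊢
      split_ifs at h ⊢ with ht
      exact ih h
    | dock m =>
      simp only [planInd, planPos] at h ⊢
      split_ifs at h ⊢ with ht
      · rw [Option.some.inj h]
      · exact ih h

theorem measurableSet_planInd_eq_none (l : List (Phase N)) :
    MeasurableSet {t | I.planInd l t = none} := by
  induction l with
  | nil => simp [planInd]
  | cons ph l ih =>
    have hshift : ∀ d : ℝ, MeasurableSet {t | I.planInd l (t - d) = none} := fun d =>
      ih.preimage (measurable_id.sub_const d)
    cases ph with
    | fly x y v =>
      have : {t | I.planInd (Phase.fly x y v :: l) t = none} =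
          Iio (‖x - y‖ / v) ∪ (Ici (‖x - y‖ / v) ∩ {t | I.planInd l (t - ‖x - y‖ / v) = none}) := by
        ext t
        by_cases ht : t < ‖x - y‖ / v <;> simp [planInd, ht, not_lt.1]
      rw [this]
      exact measurableSet_Iio.union (measurableSet_Ici.inter (hshift _))
    | dock n =>
      have : {t | I.planInd (Phase.dock n :: l) t = none} =
          Ioi (I.tau n) ∩ {t | I.planInd l (t - I.tau n) = none} := by
        ext t
        by_cases ht : t ≤ I.tau n
        · simp [planInd, ht]
        · simp [planInd, ht, not_le.1 ht]
      rw [this]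
      exact measurableSet_Ioi.inter (hshift _)

theorem fly_time_pos {x y : Plane} {v : ℝ} (h : x ≠ y) (hv : v ∈ I.speeds) : 0 < ‖x - y‖ / v :=
  div_pos (norm_pos_iff.2 (sub_ne_zero.2 h)) (I.speeds_pos v hv)

/-- A flight from `x` to `y` at speed `v` covers distance at the rate `v`. -/
theorem norm_fly_sub {x y : Plane} {v : ℝ} (h : x ≠ y) (hv : v ∈ I.speeds) {s t : ℝ}
    (hst : s ≤ t) :
    ‖x + (t / (‖x - y‖ / v)) • (y - x) - (x + (s / (‖x - y‖ / v)) • (y - x))‖ = v * (t - s) := by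
  have hd := fly_time_pos h hv
  have hv' := I.speeds_pos v hv
  have hn : 0 < ‖x - y‖ := norm_pos_iff.2 (sub_ne_zero.2 h)
  rw [add_sub_add_left_eq_sub, ← sub_smul, norm_smul, ← sub_div, norm_sub_rev y x,
    Real.norm_of_nonneg (div_nonneg (sub_nonneg.2 hst) hd.le)]
  field_simp

theorem fly_end {x y : Plane} {v : ℝ} (h : x ≠ y) (hv : v ∈ I.speeds) :
    x + ((‖x - y‖ / v) / (‖x - y‖ / v)) • (y - x) = y := by
  rw [div_self (fly_time_pos h hv).ne', one_smul, add_sub_cancel]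

namespace ValidPlan

variable {f g : Bool} {b b' : ℝ} {x : Plane} {l : List (Phase N)}

theorem mono (h : I.ValidPlan g b x l) (hfg : g = true → f = true) (hb : b ≤ b') :
    I.ValidPlan f b' x l := by
  induction h generalizing f b' with
  | nil h₀ hF => exact .nil (h₀.trans hb) hF
  | fly hxy hv _ ih => exact .fly hxy hv (ih id (by linarith))
  | dock h₀ hl _ =>
    rw [hfg rfl]
    exact .dock (h₀.trans hb) hl

theorem mem_coverage (h : I.ValidPlan f b x l) : x ∈ I.coverage := by
  induction h with
  | nil _ hF => exact hF
  | fly hxy _ _ _ => exact hxy.2 (left_mem_segment ℝ _ _)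
  | dock _ _ ih => exact ih

theorem planTime_nonneg (h : I.ValidPlan f b x l) : 0 ≤ I.planTime l := by
  induction h with
  | nil => exact le_rfl
  | fly hxy hv _ ih =>
    rw [planTime_cons]
    exact add_nonneg (fly_time_pos hxy.1 hv).le ih
  | dock _ _ ih =>
    rw [planTime_cons]
    exact add_nonneg (I.tau_nonneg _) ih

theorem planPos_zero (h : I.ValidPlan f b x l) : I.planPos l 0 = x := by
  cases h with
  | nil => rfl
  | fly hxy hv _ => simp [planPos, fly_time_pos hxy.1 hv]
  | dock => simp [planPos, I.tau_nonneg]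

theorem planPos_of_le (h : I.ValidPlan f b x l) {t : ℝ} (ht : I.planTime l ≤ t) :
    I.planPos l t = I.uF := by
  induction h generalizing t with
  | nil => rfl
  | fly hxy hv hl ih =>
    rw [planTime_cons, duration] at ht
    have := hl.planTime_nonneg
    rw [planPos, if_neg (by linarith)]
    exact ih (by linarith)
  | @dock b n l _ hl ih =>
    rw [planTime_cons, duration] at ht
    have := hl.planTime_nonneg
    rw [planPos]
    split_ifs with h
    · rw [← hl.planPos_zero]
      exact ih (by linarith)
    · exact ih (by linarith)

/-- If `s` falls in the first phase and `t` after it, the estimate is split at the junction, where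
the position is the starting point of the tail. -/
theorem norm_planPos_sub_le (h : I.ValidPlan f b x l) {s t : ℝ} (hs : 0 ≤ s) (hst : s ≤ t) :
    ‖I.planPos l t - I.planPos l s‖ ≤ I.vmax * (t - s) := by
  induction h generalizing s t with
  | nil =>
    simp only [planPos, sub_self, norm_zero]
    exact mul_nonneg I.vmax_pos.le (sub_nonneg.2 hst)
  | @fly f b x y v l hxy hv hl ih =>
    have hle : ∀ r, 0 ≤ r → v * r ≤ I.vmax * r := fun r hr =>
      mul_le_mul_of_nonneg_right (I.le_vmax hv) hr
    simp only [planPos]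
    split_ifs with h₁ h₂ h₂
    · rw [norm_fly_sub hxy.1 hv hst]
      exact hle _ (sub_nonneg.2 hst)
    · exact absurd (hst.trans_lt h₁) h₂
    · rw [not_lt] at h₁
      have e₁ := ih le_rfl (sub_nonneg.2 h₁)
      have e₂ := norm_fly_sub hxy.1 hv h₂.le
      rw [fly_end hxy.1 hv] at e₂
      rw [hl.planPos_zero] at e₁
      have e₃ := hle _ (sub_nonneg.2 h₂.le)
      have := norm_sub_le_norm_sub_add_norm_sub (I.planPos l (t - ‖x - y‖ / v)) y
        (x + (s / (‖x - y‖ / v)) • (y - x))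
      linarith
    · refine (ih (sub_nonneg.2 (not_lt.1 h₂)) (by linarith)).trans_eq (by ring)
  | @dock b n l _ hl ih =>
    simp only [planPos]
    split_ifs with h₁ h₂ h₂
    · simp only [sub_self, norm_zero]
      exact mul_nonneg I.vmax_pos.le (sub_nonneg.2 hst)
    · exact absurd (hst.trans h₁) h₂
    · rw [not_le] at h₁
      have e₁ := ih le_rfl (sub_nonneg.2 h₁.le)
      rw [hl.planPos_zero] at e₁
      refine e₁.trans ?_
      exact mul_le_mul_of_nonneg_left (by linarith) I.vmax_pos.le
    · refine (ih (sub_nonneg.2 (not_le.1 h₂).le) (by linarith)).trans_eq (by ring)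

theorem planPos_mem_coverage (h : I.ValidPlan f b x l) {t : ℝ} (ht : 0 ≤ t) :
    I.planPos l t ∈ I.coverage := by
  induction h generalizing t with
  | nil _ hF => exact hF
  | @fly f b x y v l hxy hv hl ih =>
    rw [planPos]
    have hd := fly_time_pos hxy.1 hv
    split_ifs with h₁
    · refine hxy.2 ?_
      rw [segment_eq_image']
      exact ⟨_, ⟨div_nonneg ht hd.le, (div_le_one hd).2 h₁.le⟩, rfl⟩
    · exact ih (sub_nonneg.2 (not_lt.1 h₁))
  | @dock b n l _ hl ih =>
    rw [planPos]
    split_ifs with h₁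
    · exact hl.mem_coverage
    · exact ih (sub_nonneg.2 (not_le.1 h₁).le)

theorem planUsed_zero (h : I.ValidPlan f b x l) : I.planUsed l 0 = 0 := by
  cases h with
  | nil => rfl
  | fly hxy hv _ => simp [planUsed, fly_time_pos hxy.1 hv]
  | dock => simp [planUsed, I.tau_nonneg]

/-- Continuity at the breakpoints allows the fundamental theorem of calculus to ignore the finitely
many times without a derivative. -/
theorem continuous_planUsed (h : I.ValidPlan f b x l) : Continuous (I.planUsed l) := by
  induction h with
  | nil => exact continuous_const
  | @fly f b x y v l hxy hv hl ih =>
    have heq : I.planUsed (Phase.fly x y v :: l) = fun t => if ‖x - y‖ / v ≤ t then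
        I.cost v * ‖x - y‖ + I.planUsed l (t - ‖x - y‖ / v) else t * (I.power v / I.eta) := by
      ext t
      by_cases ht : t < ‖x - y‖ / v
      · rw [planUsed, if_pos ht, if_neg (not_le.2 ht)]
      · rw [planUsed, if_neg ht, if_pos (not_lt.1 ht)]
    rw [heq]
    refine Continuous.if_le (by fun_prop) (by fun_prop) continuous_const continuous_id
      fun t ht => ?_
    obtain rfl : ‖x - y‖ / v = t := ht
    rw [sub_self, hl.planUsed_zero, add_zero, I.cost_mul (I.speeds_pos v hv)]
  | @dock b n l _ hl ih =>
    have heq : I.planUsed (Phase.dock n :: l) = fun t => if t ≤ I.tau n then 0 else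
        I.planUsed l (t - I.tau n) := by
      ext t
      rw [planUsed]
    rw [heq]
    refine Continuous.if_le continuous_const (by fun_prop) continuous_id continuous_const
      fun t ht => ?_
    obtain rfl : t = I.tau n := ht
    rw [sub_self, hl.planUsed_zero]

theorem phaseSpeed_mem (h : I.ValidPlan f b x l) : ∀ ph ∈ l, phaseSpeed ph ∈ I.speedSet := by
  induction h with
  | nil => simp
  | fly _ hv _ ih =>
    rw [List.forall_mem_cons]
    exact ⟨Or.inr hv, ih⟩
  | dock _ _ ih =>
    rw [List.forall_mem_cons]
    exact ⟨Or.inl rfl, ih⟩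

/-- Except at finitely many times, a flight plan moves at the speed of one of its phases, and
consumes energy at the corresponding rate. -/
theorem exists_finite_hasDerivAt (h : I.ValidPlan f b x l) :
    ∃ D : Set ℝ, D.Finite ∧ ∀ t, 0 < t → t < I.planTime l → t ∉ D → ∃ w,
      HasDerivAt (I.planPos l) w t ∧ (∃ ph ∈ l, ‖w‖ = phaseSpeed ph) ∧
      HasDerivAt (I.planUsed l)
        (if I.planInd l t = none then I.power ‖w‖ / I.eta else 0) t := by
  induction h with
  | nil => exact ⟨∅, finite_empty, fun t h₀ h₁ => absurd (h₀.trans h₁) (lt_irrefl _)⟩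
  | @fly f b x y v l hxy hv hl ih =>
    obtain ⟨D, hD, ih⟩ := ih
    set d := ‖x - y‖ / v with hd
    have hdpos : 0 < d := fly_time_pos hxy.1 hv
    refine ⟨insert d ((· + d) '' D), (hD.image _).insert _, fun t h₀ h₁ hne => ?_⟩
    rw [planTime_cons, duration, ← hd] at h₁
    simp only [mem_insert_iff, mem_image, not_or, not_exists, not_and] at hne
    rcases lt_or_gt_of_ne hne.1 with hlt | hgt
    · have hev : ∀ᶠ s in 𝓝 t, s < d := eventually_lt_nhds hlt
      refine ⟨(1 / d) • (y - x), ?_, ⟨_, List.mem_cons_self, ?_⟩, ?_⟩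
      · have : HasDerivAt (fun s : ℝ => x + (s / d) • (y - x)) ((1 / d) • (y - x)) t :=
          (((hasDerivAt_id t).div_const d).smul_const (y - x)).const_add x
        refine this.congr_of_eventuallyEq (hev.mono fun s hs => ?_)
        rw [planPos, ← hd, if_pos hs]
      · have hn : 0 < ‖x - y‖ := norm_pos_iff.2 (sub_ne_zero.2 hxy.1)
        have := I.speeds_pos v hv
        rw [norm_smul, Real.norm_of_nonneg (by positivity), norm_sub_rev, phaseSpeed, hd]
        field_simp
      · have hn : ‖(1 / d) • (y - x)‖ = v := by
          have hn : 0 < ‖x - y‖ := norm_pos_iff.2 (sub_ne_zero.2 hxy.1)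
          have := I.speeds_pos v hv
          rw [norm_smul, Real.norm_of_nonneg (by positivity), norm_sub_rev, hd]
          field_simp
        rw [planInd, ← hd, if_pos hlt, if_pos rfl, hn]
        have : HasDerivAt (fun s : ℝ => s * (I.power v / I.eta)) (1 * (I.power v / I.eta)) t :=
          (hasDerivAt_id t).mul_const _
        rw [one_mul] at this
        refine this.congr_of_eventuallyEq (hev.mono fun s hs => ?_)
        rw [planUsed, ← hd, if_pos hs]
    · have hev : ∀ᶠ s in 𝓝 t, ¬ s < d := (eventually_gt_nhds hgt).mono fun s hs => hs.not_gt
      obtain ⟨w, h₁, ⟨ph, hph, h₂⟩, h₃⟩ := ih (t - d) (by linarith) (by linarith)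
        fun hmem => hne.2 _ hmem (by ring)
      refine ⟨w, ?_, ⟨ph, List.mem_cons_of_mem _ hph, h₂⟩, ?_⟩
      · refine (h₁.comp_sub_const t d).congr_of_eventuallyEq (hev.mono fun s hs => ?_)
        rw [planPos, ← hd, if_neg hs]
      · rw [planInd, ← hd, if_neg hgt.not_gt]
        refine ((h₃.comp_sub_const t d).const_add (I.cost v * ‖x - y‖)).congr_of_eventuallyEq
          (hev.mono fun s hs => ?_)
        rw [planUsed, ← hd, if_neg hs]
  | @dock b n l _ hl ih =>
    obtain ⟨D, hD, ih⟩ := ih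
    set d := I.tau n with hd
    refine ⟨insert d ((· + d) '' D), (hD.image _).insert _, fun t h₀ h₁ hne => ?_⟩
    rw [planTime_cons, duration, ← hd] at h₁
    simp only [mem_insert_iff, mem_image, not_or, not_exists, not_and] at hne
    rcases lt_or_gt_of_ne hne.1 with hlt | hgt
    · have hev : ∀ᶠ s in 𝓝 t, s ≤ d := (eventually_lt_nhds hlt).mono fun s hs => hs.le
      refine ⟨0, ?_, ⟨_, List.mem_cons_self, by simp [phaseSpeed]⟩, ?_⟩
      · refine (hasDerivAt_const t (I.c n)).congr_of_eventuallyEq (hev.mono fun s hs => ?_)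
        rw [planPos, ← hd, if_pos hs]
      · rw [planInd, ← hd, if_pos hlt.le, if_neg (by simp)]
        refine (hasDerivAt_const t (0 : ℝ)).congr_of_eventuallyEq (hev.mono fun s hs => ?_)
        rw [planUsed, ← hd, if_pos hs]
    · have hev : ∀ᶠ s in 𝓝 t, ¬ s ≤ d := (eventually_gt_nhds hgt).mono fun s hs => hs.not_ge
      obtain ⟨w, h₁, ⟨ph, hph, h₂⟩, h₃⟩ := ih (t - d) (by linarith) (by linarith)
        fun hmem => hne.2 _ hmem (by ring)
      refine ⟨w, ?_, ⟨ph, List.mem_cons_of_mem _ hph, h₂⟩, ?_⟩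
      · refine (h₁.comp_sub_const t d).congr_of_eventuallyEq (hev.mono fun s hs => ?_)
        rw [planPos, ← hd, if_neg hs]
      · rw [planInd, ← hd, if_neg hgt.not_ge]
        refine (h₃.comp_sub_const t d).congr_of_eventuallyEq (hev.mono fun s hs => ?_)
        rw [planUsed, ← hd, if_neg hs]

theorem lipschitzOnWith (h : I.ValidPlan f b x l) :
    ∃ K, LipschitzOnWith K (I.planPos l) (Icc 0 (I.planTime l)) := by
  refine ⟨I.vmax.toNNReal, LipschitzOnWith.of_dist_le_mul fun s hs t ht => ?_⟩
  rw [Real.coe_toNNReal _ I.vmax_pos.le, dist_eq_norm, Real.dist_eq]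
  rcases le_total s t with hst | hst
  · rw [norm_sub_rev, abs_sub_comm, abs_of_nonneg (sub_nonneg.2 hst)]
    exact h.norm_planPos_sub_le hs.1 hst
  · rw [abs_of_nonneg (sub_nonneg.2 hst)]
    exact h.norm_planPos_sub_le ht.1 hst

theorem ae_speed (h : I.ValidPlan f b x l) : ∀ᵐ t, t ∈ Icc 0 (I.planTime l) →
    DifferentiableAt ℝ (I.planPos l) t ∧ ∃ ph ∈ l, ‖deriv (I.planPos l) t‖ = phaseSpeed ph := by
  obtain ⟨D, hD, hder⟩ := h.exists_finite_hasDerivAt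
  have hD' : (D ∪ {0, I.planTime l}).Finite := hD.union (toFinite _)
  filter_upwards [measure_eq_zero_iff_ae_notMem.1 (hD'.measure_zero volume)] with t ht hI
  simp only [mem_union, mem_insert_iff, mem_singleton_iff, not_or] at ht
  obtain ⟨w, h₁, h₂, -⟩ := hder t (lt_of_le_of_ne hI.1 (Ne.symm ht.2.1))
    (lt_of_le_of_ne hI.2 ht.2.2) ht.1
  exact ⟨h₁.differentiableAt, by rwa [h₁.deriv]⟩

theorem measurableSet_airborne (l : List (Phase N)) : MeasurableSet
    {t | t ∈ Icc 0 (I.planTrajectory l).T ∧ (I.planTrajectory l).ψ t = none} :=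
  measurableSet_Icc.inter (measurableSet_planInd_eq_none l)

theorem ae_speed_mem (h : I.ValidPlan f b x l) : ∀ᵐ t, t ∈ Icc 0 (I.planTrajectory l).T →
    DifferentiableAt ℝ (I.planTrajectory l).u t ∧
      ‖deriv (I.planTrajectory l).u t‖ ∈ I.speedSet := by
  filter_upwards [h.ae_speed] with t ht hI
  obtain ⟨h₁, ph, hph, h₂⟩ := ht hI
  exact ⟨h₁, h₂ ▸ h.phaseSpeed_mem ph hph⟩

/-- The energy consumption of a flight plan. -/
theorem energyUsed_eq (h : I.ValidPlan f b x l) {s t : ℝ} (hs : 0 ≤ s) (hst : s ≤ t)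
    (ht : t ≤ I.planTime l) :
    I.energyUsed (I.planTrajectory l) s t = I.planUsed l t - I.planUsed l s := by
  rw [energyUsed_eq_integral_rate (measurableSet_airborne l) hs hst ht]
  obtain ⟨D, hD, hder⟩ := h.exists_finite_hasDerivAt
  refine integral_eq_of_hasDerivAt_off_countable_of_le _ _ hst hD.countable
    h.continuous_planUsed.continuousOn (fun r hr => ?_) ?_
  · obtain ⟨w, h₁, -, h₃⟩ := hder r (hs.trans_lt hr.1.1) (hr.1.2.trans_le ht) hr.2
    have hrI : r ∈ Icc 0 (I.planTime l) := ⟨hs.trans hr.1.1.le, hr.1.2.le.trans ht⟩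
    have hrate : I.rate (I.planTrajectory l) r =
        if I.planInd l r = none then I.power ‖w‖ / I.eta else 0 := by
      have hw : deriv (I.planTrajectory l).u r = w := h₁.deriv
      simp only [rate, indicator, mem_ofPred_eq, hw]
      refine if_congr ?_ rfl rfl
      exact and_iff_right hrI
    rw [hrate]
    exact h₃
  · rw [intervalIntegrable_iff_integrableOn_Icc_of_le hst]
    exact (integrableOn_rate_of (measurableSet_airborne l) h.ae_speed_mem).mono_set
      (Icc_subset_Icc hs ht)

end ValidPlan

end Mission

/-! ### Valid flight plans are feasible trajectories -/

namespace Mission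

open Set Filter Topology Metric MeasureTheory

variable {M N : ℕ} {I : Mission M N}

namespace ValidPlan

variable {f : Bool} {b : ℝ} {x : Plane} {l l₁ l₂ : List (Phase N)}

theorem nonneg (h : I.ValidPlan f b x l) : 0 ≤ b := by
  induction h with
  | nil h _ => exact h
  | @fly f b x y v l _ hv _ ih =>
    have := mul_nonneg (I.cost_pos (I.speeds_pos v hv)).le (norm_nonneg (x - y))
    linarith
  | dock h _ _ => exact h

theorem exists_suffix (h : I.ValidPlan f b x (l₁ ++ l)) :
    0 ≤ I.planTime l₁ ∧ ∃ f b x, I.ValidPlan f b x l := by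
  induction l₁ generalizing f b x with
  | nil => exact ⟨le_rfl, f, b, x, h⟩
  | cons ph l₁ ih =>
    rw [List.cons_append] at h
    rw [planTime_cons]
    cases h with
    | fly hxy hv hl =>
      obtain ⟨h₁, h₂⟩ := ih hl
      exact ⟨add_nonneg (fly_time_pos hxy.1 hv).le h₁, h₂⟩
    | dock _ hl =>
      obtain ⟨h₁, h₂⟩ := ih hl
      exact ⟨add_nonneg (I.tau_nonneg _) h₁, h₂⟩

theorem planUsed_append (h : I.ValidPlan f b x (l₁ ++ l)) {t : ℝ} (ht : I.planTime l₁ ≤ t) :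
    I.planUsed (l₁ ++ l) t = I.planCost l₁ + I.planUsed l (t - I.planTime l₁) := by
  induction l₁ generalizing f b x t with
  | nil => simp [planCost, planTime]
  | cons ph l₁ ih =>
    rw [List.cons_append] at h ⊢
    rw [planTime_cons] at ht ⊢
    rw [planCost_cons]
    cases h with
    | @fly _ _ _ y v _ hxy hv hl =>
      have := hl.exists_suffix.1
      rw [duration] at ht ⊢
      rw [planUsed, if_neg (by linarith), ih hl (by linarith), phaseCost, add_assoc, sub_sub]
    | @dock _ n _ h₀ hl =>
      have := hl.exists_suffix.1
      rw [duration] at ht ⊢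
      rw [planUsed, phaseCost, zero_add, ← sub_sub, ← ih hl (by linarith)]
      -- If `t` is the very end of the stay, the stay takes precedence over the tail, but both
      -- values are zero.
      split_ifs with h'
      · rw [show t - I.tau n = 0 by linarith, hl.planUsed_zero]
      · rfl

/-- The inequality is strict because a stay at the end of `l₁` still includes the junction itself.
-/
theorem planInd_append_of_lt (h : I.ValidPlan f b x (l₁ ++ l)) {t : ℝ}
    (ht : I.planTime l₁ < t) : I.planInd (l₁ ++ l) t = I.planInd l (t - I.planTime l₁) := by
  induction l₁ generalizing f b x t with
  | nil => simp [planTime]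
  | cons ph l₁ ih =>
    rw [List.cons_append] at h ⊢
    rw [planTime_cons] at ht ⊢
    cases h with
    | @fly _ _ _ y v _ hxy hv hl =>
      have := hl.exists_suffix.1
      rw [duration] at ht ⊢
      rw [planInd, if_neg (by linarith), ih hl (by linarith), sub_sub]
    | @dock _ n _ h₀ hl =>
      have := hl.exists_suffix.1
      rw [duration] at ht ⊢
      rw [planInd, if_neg (by linarith), ih hl (by linarith), sub_sub]

/-- A flight plan replaces the battery at the end of each stay. -/
theorem isSwap {n : Fin N} (h : I.ValidPlan f b x (l₁ ++ Phase.dock n :: l₂))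
    (hl₁ : l₁ = [] ∨ ∃ l' y z v, l₁ = l' ++ [Phase.fly y z v]) :
    I.IsSwap (I.planTrajectory (l₁ ++ Phase.dock n :: l₂)) (I.planTime l₁ + I.tau n) := by
  have hτ := I.tau_nonneg n
  have hσ := h.exists_suffix.1
  rcases hl₁ with rfl | ⟨l', y, z, v, rfl⟩
  · have hind : ∀ t ≤ I.tau n, I.planInd (Phase.dock n :: l₂) t = some n := fun t ht => by
      rw [planInd, if_pos ht]
    rw [planTime_nil, zero_add, List.nil_append]
    refine ⟨n, hind _ le_rfl, ?_⟩
    -- Here the UAV has not been airborne yet; the default `sSup ∅ = 0` agrees with counting the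
    -- delay from time `0`.
    have : {t₁ | t₁ ∈ Icc 0 (I.tau n) ∧
        (I.planTrajectory (Phase.dock n :: l₂)).ψ t₁ = none} = ∅ := by
      rw [eq_empty_iff_forall_notMem]
      rintro t ⟨ht, hψ⟩
      have := (hind t ht.2).symm.trans hψ
      simp at this
    rw [lastAirborne, this, Real.sSup_empty, sub_zero]
  · rw [List.append_assoc, List.singleton_append] at h ⊢
    obtain ⟨hσ', _, _, _, hsuff⟩ := h.exists_suffix
    rw [planTime_append, planTime_cons, planTime_nil, add_zero, duration] at hσ ⊢
    have hd : 0 < ‖y - z‖ / v := by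
      cases hsuff with
      | fly hxy hv _ => exact fly_time_pos hxy.1 hv
    set σ' := I.planTime l' with hσ'_def
    set d := ‖y - z‖ / v with hd_def
    have hdock : ∀ t, σ' + d ≤ t → t ≤ σ' + d + I.tau n →
        I.planInd (l' ++ Phase.fly y z v :: Phase.dock n :: l₂) t = some n := by
      intro t h₁ h₂
      rw [h.planInd_append_of_lt (by linarith), planInd, if_neg (by linarith), planInd,
        if_pos (by linarith)]
    have hfly : ∀ t, σ' < t → t < σ' + d →
        I.planInd (l' ++ Phase.fly y z v :: Phase.dock n :: l₂) t = none := by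
      intro t h₁ h₂
      rw [h.planInd_append_of_lt h₁, planInd, if_pos (by linarith)]
    refine ⟨n, hdock _ (by linarith) le_rfl, ?_⟩
    suffices hs : lastAirborne (I.planTrajectory (l' ++ Phase.fly y z v :: Phase.dock n :: l₂))
        (σ' + d + I.tau n) = σ' + d by
      rw [hs]
      ring
    -- The supremum is not attained, as the indicator has switched at the instant of arrival. The
    -- flight before it has positive duration, so airborne times accumulate at that instant.
    refine csSup_eq_of_forall_le_of_forall_lt_exists_gt ?_ ?_ ?_
    · exact ⟨σ' + d / 2, ⟨by linarith, by linarith⟩, hfly _ (by linarith) (by linarith)⟩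
    · rintro t ⟨ht, hψ⟩
      by_contra! hlt
      have := (hdock t hlt.le ht.2).symm.trans hψ
      simp at this
    · intro w hw
      obtain ⟨t, ht₁, ht₂⟩ := exists_between (max_lt hw (by linarith : σ' < σ' + d))
      rw [max_lt_iff] at ht₁
      exact ⟨t, ⟨⟨by linarith, by linarith⟩, hfly t ht₁.2 ht₂⟩, ht₁.1⟩

/-- At any time, a valid flight plan has consumed at most the budget since some earlier battery
replacement. -/
theorem exists_isSwap_le {L : List (Phase N)} {x₀ : Plane} (hL : I.ValidPlan true I.budget x₀ L)
    (h : I.ValidPlan f b x l) : ∀ {l₁ : List (Phase N)} {s₀ : ℝ}, L = l₁ ++ l →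
    (f = true → l₁ = [] ∨ ∃ l' y z v, l₁ = l' ++ [Phase.fly y z v]) →
    0 ≤ s₀ → s₀ ≤ I.planTime l₁ → (s₀ = 0 ∨ I.IsSwap (I.planTrajectory L) s₀) →
    I.planCost l₁ - I.planUsed L s₀ ≤ I.budget - b →
    ∀ t, I.planTime l₁ ≤ t → t ≤ I.planTime L →
    ∃ s, 0 ≤ s ∧ s ≤ t ∧ (s = 0 ∨ I.IsSwap (I.planTrajectory L) s) ∧
      I.planUsed L t - I.planUsed L s ≤ I.budget := by
  -- `l₁` is the part of the plan already executed, `s₀` is time `0` or a replacement time before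
  -- its end, and the consumption of `l₁` since `s₀` is at most `budget - b`. So `b` bounds what may
  -- still be consumed before the next replacement.
  induction h with
  | nil h₀ _ =>
    intro l₁ s₀ hLe _ h0 hs hswap hcost t ht hT
    refine ⟨s₀, h0, hs.trans ht, hswap, ?_⟩
    have := (hLe ▸ hL).planUsed_append ht
    rw [← hLe] at this
    rw [this, planUsed, add_zero]
    linarith
  | @fly f b x y v l hxy hv hl ih =>
    intro l₁ s₀ hLe _ h0 hs hswap hcost t ht hT
    have hpos := I.speeds_pos v hv
    have hd := fly_time_pos hxy.1 hv
    by_cases hlt : t - I.planTime l₁ < ‖x - y‖ / v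
    · refine ⟨s₀, h0, hs.trans ht, hswap, ?_⟩
      have := (hLe ▸ hL).planUsed_append ht
      rw [← hLe] at this
      rw [this, planUsed, if_pos hlt]
      have h₁ : (t - I.planTime l₁) * (I.power v / I.eta) ≤ I.cost v * ‖x - y‖ := by
        rw [I.cost_mul hpos]
        exact mul_le_mul_of_nonneg_right hlt.le (div_pos (I.power_pos hpos.le) I.eta_pos).le
      have h₂ := hl.nonneg
      linarith
    · have htime : I.planTime (l₁ ++ [Phase.fly x y v]) = I.planTime l₁ + ‖x - y‖ / v := by
        rw [planTime_append, planTime_cons, planTime_nil, add_zero, duration]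
      refine ih (l₁ := l₁ ++ [Phase.fly x y v]) (s₀ := s₀) (by simp [hLe])
        (fun _ => Or.inr ⟨_, _, _, _, rfl⟩) h0 (by linarith) hswap ?_ t (by linarith) hT
      rw [planCost_append, planCost_cons, phaseCost]
      simp only [planCost, List.map_nil, List.sum_nil, add_zero]
      simp only [planCost] at hcost
      linarith
  | @dock b n l h₀ hl ih =>
    intro l₁ s₀ hLe hfly h0 hs hswap hcost t ht hT
    have hτ := I.tau_nonneg n
    have htot := (hLe ▸ hL).exists_suffix.1
    by_cases hle : t - I.planTime l₁ ≤ I.tau n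
    · refine ⟨s₀, h0, hs.trans ht, hswap, ?_⟩
      have := (hLe ▸ hL).planUsed_append ht
      rw [← hLe] at this
      rw [this, planUsed, if_pos hle]
      linarith
    · have htime : I.planTime (l₁ ++ [Phase.dock n]) = I.planTime l₁ + I.tau n := by
        rw [planTime_append, planTime_cons, planTime_nil, add_zero, duration]
      have hsw : I.IsSwap (I.planTrajectory L) (I.planTime l₁ + I.tau n) := by
        have := (hLe ▸ hL).isSwap (hfly rfl)
        rwa [← hLe] at this
      -- The end of the stay becomes the new `s₀`, and the allowance is the full budget again.
      refine ih (l₁ := l₁ ++ [Phase.dock n]) (s₀ := I.planTime l₁ + I.tau n) (by simp [hLe])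
        (by simp) (by linarith) htime.ge (Or.inr hsw) ?_ t (by linarith) hT
      have := (hLe ▸ hL).planUsed_append (t := I.planTime l₁ + I.tau n) (by linarith)
      rw [← hLe] at this
      rw [this, planUsed, if_pos (by linarith), planCost_append, planCost_cons, phaseCost]
      simp [planCost]

theorem planUsed_planTime (h : I.ValidPlan f b x l) :
    I.planUsed l (I.planTime l) = I.planCost l := by
  have h' : I.ValidPlan f b x (l ++ []) := by rwa [List.append_nil]
  have := h'.planUsed_append le_rfl
  rwa [List.append_nil, planUsed, add_zero] at this

theorem isFeasible (h : I.ValidPlan true I.budget I.u₀ l) : I.IsFeasible (I.planTrajectory l) where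
  time_nonneg := h.planTime_nonneg
  initial := h.planPos_zero
  final := h.planPos_of_le le_rfl
  lipschitz := h.lipschitzOnWith
  speed := h.ae_speed_mem
  measurable_airborne := measurableSet_airborne l
  connected t ht := I.covered_iff.2 (h.planPos_mem_coverage ht.1)
  airborne t ht hne := by
    by_contra hψ
    obtain ⟨n, hn⟩ := Option.ne_none_iff_exists'.1 hψ
    exact hne n (planInd_eq_some hn)
  docked t ht n hn := by
    rcases hψ : (I.planTrajectory l).ψ t with _ | m
    · exact Or.inl rfl
    · rw [I.c_injective ((planInd_eq_some hψ).symm.trans hn)]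
      exact Or.inr rfl
  energy t ht := by
    obtain ⟨s, hs, hst, hswap, hle⟩ := h.exists_isSwap_le h (l₁ := []) (s₀ := 0) rfl
      (fun _ => Or.inl rfl) le_rfl le_rfl (Or.inl rfl) (by simp [planCost, h.planUsed_zero])
      t ht.1 ht.2
    have hub : ∀ a ∈ insert 0 {s | s ∈ Icc 0 t ∧ I.IsSwap (I.planTrajectory l) s}, a ≤ t := by
      rintro a (rfl | ha)
      exacts [ht.1, ha.1.2]
    -- It suffices that `lastFull` is not earlier than `s`, since less is consumed from a later time
    -- on.
    have hs' : s ≤ I.lastFull (I.planTrajectory l) t := by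
      refine le_csSup ⟨t, hub⟩ ?_
      rcases hswap with rfl | hswap
      exacts [mem_insert _ _, Or.inr ⟨⟨hs, hst⟩, hswap⟩]
    have hle' : I.lastFull (I.planTrajectory l) t ≤ t := csSup_le (insert_nonempty _ _) hub
    have hmono : 0 ≤ I.planUsed l (I.lastFull (I.planTrajectory l) t) - I.planUsed l s := by
      have hT := hle'.trans ht.2
      rw [← h.energyUsed_eq hs hs' hT,
        energyUsed_eq_integral_rate (measurableSet_airborne l) hs hs' hT]
      exact intervalIntegral.integral_nonneg hs' fun _ _ => rate_nonneg _
    rw [battery, h.energyUsed_eq (hs.trans hs') hle' ht.2]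
    have : (1 - I.gam / I.rsafe) * I.capacity = I.capacity - I.budget := by
      rw [budget]
      ring
    linarith

theorem totalEnergy_eq (h : I.ValidPlan f b x l) :
    I.totalEnergy (I.planTrajectory l) = I.planCost l := by
  rw [← h.planUsed_planTime, ← sub_zero (I.planUsed l _), ← h.planUsed_zero]
  exact h.energyUsed_eq le_rfl h.planTime_nonneg le_rfl

/-- Flights along a polygon within the coverage map can be prefixed to a flight plan. -/
theorem flyAlong_append {g : Bool} {v : ℝ} {y : Plane} {Z : List Plane}
    (hl : I.ValidPlan g (b - I.cost v * pathLength Z) y l) (hv : v ∈ I.speeds)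
    (hZ : IsVisitingSeq I.Visible x y Z) (hg : g = true → x ≠ y ∨ f = true) :
    I.ValidPlan f b x (flyAlong N v Z ++ l) := by
  induction Z generalizing x f b with
  | nil => simp [IsVisitingSeq] at hZ
  | cons x' Z ih =>
    obtain rfl : x' = x := by simpa using hZ.2.1
    cases Z with
    | nil =>
      obtain rfl : x' = y := by simpa using hZ.2.2
      rw [flyAlong, List.nil_append]
      -- A one-point polygon produces no flight, so a stay may follow only if it was allowed before;
      -- this is what `hg` provides.
      · refine hl.mono (fun h => (hg h).resolve_left (fun h => h rfl)) ?_
        rw [pathLength_singleton, mul_zero, sub_zero]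
      · simp
    | cons z Z =>
      obtain ⟨hxz, hz⟩ := isVisitingSeq_cons_cons.1 hZ
      rw [flyAlong, List.cons_append]
      refine .fly hxz hv (ih ?_ hz fun _ => Or.inr rfl)
      rwa [sub_sub, ← mul_add, ← pathLength_cons_cons]

end ValidPlan

theorem phaseSpeed_of_mem_flyAlong {v : ℝ} {Z : List Plane} {ph : Phase N}
    (h : ph ∈ flyAlong N v Z) : phaseSpeed ph = v := by
  induction Z with
  | nil => simp [flyAlong] at h
  | cons x Z ih =>
    cases Z with
    | nil => simp [flyAlong] at h
    | cons y Z =>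
      rw [flyAlong, List.mem_cons] at h
      rcases h with rfl | h
      exacts [rfl, ih h]

/-- The ends of a polygon within the coverage map can be joined at constant speed. -/
theorem chkFea_of_isVisitingSeq {x y : Plane} {Z : List Plane}
    (hZ : IsVisitingSeq I.Visible x y Z) (hy : y ∈ I.coverage) : I.ChkFea x y := by
  -- Moving the final point to `y` makes the results on flight plans applicable; coverage and speeds
  -- are unchanged.
  set J : Mission M N := { I with uF := y }
  have hplan : J.ValidPlan false (J.cost J.vmax * pathLength Z) x (flyAlong N J.vmax Z ++ []) :=
    ValidPlan.flyAlong_append (g := false) (.nil (by rw [sub_self]) hy) J.vmax_mem hZ (by simp)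
  rw [List.append_nil] at hplan
  refine ⟨_, J.planPos (flyAlong N J.vmax Z), hplan.planTime_nonneg, hplan.planPos_zero,
    hplan.planPos_of_le le_rfl, hplan.lipschitzOnWith, ?_, fun t ht => ?_⟩
  · filter_upwards [hplan.ae_speed] with t ht hI
    obtain ⟨h₁, ph, hph, h₂⟩ := ht hI
    exact ⟨h₁, h₂.trans (phaseSpeed_of_mem_flyAlong hph)⟩
  · exact J.covered_iff.2 (hplan.planPos_mem_coverage ht.1)

end Mission

namespace Mission

open Set Filter Topology Metric MeasureTheory

variable {M N : ℕ} {I : Mission M N}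

/-! ### The local and the global graph -/

/-- The outage test with step `ε` is correct for each pair of vertices. -/
def IsExactStep (I : Mission M N) (ε : ℝ) : Prop :=
  ∀ x y, I.Survives ε x y ↔ x ∈ I.Vall ∧ y ∈ I.Vall ∧ x ≠ y ∧ segment ℝ x y ⊆ I.coverage

variable {ε : ℝ} {loc : LocalTable N}

theorem IsExactStep.visible (hε : I.IsExactStep ε) {n n' : Node N} {x y : Plane}
    (h : I.adjLoc ε n n' x y) : I.Visible x y := by
  have hs : I.Survives ε x y := by
    rcases h.2.2 with h | h | h
    exacts [h.1, h.1, h.1]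
  exact ((hε x y).1 hs).2.2

theorem finite_Vloc (n n' : Node N) : (I.Vloc n n').Finite :=
  I.finite_Vin.union (toFinite _)

theorem exists_isLocalTable (I : Mission M N) (ε : ℝ) : ∃ loc, I.IsLocalTable ε loc := by
  classical
  refine ⟨fun n n' => if h : ∃ q : List Plane × ℝ, I.IsLocalResult ε n n' q.1 q.2 then
    some h.choose else none, fun n n' => ⟨fun S v h => ?_, fun h S v hr => ?_⟩⟩
  · dsimp only at h
    split_ifs at h with hex
    have := hex.choose_spec
    rw [Option.some.inj h] at this
    exact this
  · have hex : ∃ q : List Plane × ℝ, I.IsLocalResult ε n n' q.1 q.2 := ⟨(S, v), hr⟩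
    simp only [dif_pos hex] at h
    simp at h

theorem ChkFea.mem_coverage {x y : Plane} (h : I.ChkFea x y) :
    x ∈ I.coverage ∧ y ∈ I.coverage := by
  obtain ⟨T, u, hT, rfl, rfl, -, -, hcov⟩ := h
  exact ⟨I.covered_iff.1 (hcov 0 (left_mem_Icc.2 hT)), I.covered_iff.1 (hcov T (right_mem_Icc.2 hT))⟩

theorem IsLocalTable.isLocalResult (hloc : I.IsLocalTable ε loc) {n n' : Node N}
    (h : adjGlob loc n n') : ∃ S v, loc n n' = some (S, v) ∧ I.IsLocalResult ε n n' S v := by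
  obtain ⟨⟨S, v⟩, hS⟩ := Option.isSome_iff_exists.1 h
  exact ⟨S, v, hS, (hloc n n').1 S v hS⟩

theorem IsLocalTable.weightGlob_eq (hloc : I.IsLocalTable ε loc) {n n' : Node N}
    {S : List Plane} {v : ℝ} (h : loc n n' = some (S, v)) :
    I.weightGlob loc n n' = I.cost v * pathLength S := by
  have hv := I.speeds_pos v ((hloc n n').1 S v h).2.2.2.2.2.1
  rw [weightGlob, h, I.cost_mul hv]

theorem IsLocalTable.weightGlob_nonneg (hloc : I.IsLocalTable ε loc) (n n' : Node N) :
    0 ≤ I.weightGlob loc n n' := by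
  rcases h : loc n n' with _ | ⟨S, v⟩
  · rw [weightGlob, h]
  · have hv := I.speeds_pos v ((hloc n n').1 S v h).2.2.2.2.2.1
    rw [hloc.weightGlob_eq h]
    exact mul_nonneg (I.cost_pos hv).le (pathLength_nonneg S)

theorem exists_isOutput (I : Mission M N) (ε : ℝ) : ∃ out, I.IsOutput ε out := by
  obtain ⟨loc, hloc⟩ := exists_isLocalTable I ε
  by_cases h : ∃ S, IsVisitingSeq (adjGlob loc) Node.start Node.goal S
  · obtain ⟨S, hS⟩ := h
    obtain ⟨S', hS'⟩ := exists_isDijkstraOutput (V := univ) finite_univ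
      (fun _ _ _ => ⟨mem_univ _, mem_univ _⟩) hloc.weightGlob_nonneg hS
    exact ⟨_, loc, hloc, Or.inl ⟨S', hS', rfl⟩⟩
  · exact ⟨none, loc, hloc, Or.inr ⟨h, rfl⟩⟩

/-! ### The output trajectory is feasible -/

theorem planCost_flyAlong (v : ℝ) (Z : List Plane) :
    I.planCost (flyAlong N v Z) = I.cost v * pathLength Z := by
  induction Z with
  | nil => simp [flyAlong, planCost, pathLength, aggWeight]
  | cons x Z ih =>
    cases Z with
    | nil => simp [flyAlong, planCost, pathLength, aggWeight]
    | cons y Z => rw [flyAlong, planCost_cons, ih, phaseCost, pathLength_cons_cons, mul_add]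

theorem planCost_dockAt (n : Node N) : I.planCost (dockAt n) = 0 := by
  cases n <;> simp [dockAt, planCost, phaseCost]

theorem IsLocalTable.planCost_flightPlan (hloc : I.IsLocalTable ε loc) {n n' : Node N}
    {S : List (Node N)} (h : IsVisitingSeq (adjGlob loc) n n' S) :
    I.planCost (flightPlan loc S) = aggWeight (I.weightGlob loc) S := by
  refine h.induction (motive := fun _ S =>
    I.planCost (flightPlan loc S) = aggWeight (I.weightGlob loc) S) ?_ fun a b l hab _ ih => ?_
  · simp [flightPlan, aggWeight, planCost]
  · obtain ⟨S', v, heq, -⟩ := hloc.isLocalResult hab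
    rw [flightPlan, planCost_append, planCost_append, ih, planCost_dockAt, add_zero, aggWeight,
      hloc.weightGlob_eq heq, heq, planCost_flyAlong]

/-- Whether a flight plan that starts in a node may begin with a stay. -/
def mayDock : Node N → Bool
  | Node.start => true
  | _ => false

/-- Each global edge is a visible polygon that one battery can afford. Different charging stations
have different positions, so a genuine flight separates two stays. Only the initial point may
coincide with the first station reached, which is why `mayDock` is true there. -/
theorem IsLocalTable.validPlan_flightPlan (hloc : I.IsLocalTable ε loc) (hε : I.IsExactStep ε)
    {n : Node N} {S : List (Node N)} (h : IsVisitingSeq (adjGlob loc) n Node.goal S) :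
    I.pos n ∈ I.coverage → I.ValidPlan (mayDock n) I.budget (I.pos n) (flightPlan loc S) := by
  refine h.induction (motive := fun n S => I.pos n ∈ I.coverage →
    I.ValidPlan (mayDock n) I.budget (I.pos n) (flightPlan loc S)) ?_ fun a b l hab hb ih _ => ?_
  · exact fun hcov => .nil I.budget_pos.le hcov
  · obtain ⟨S', v, heq, ha, hbs, hne, hchk, ⟨hS', -⟩, hv, hdfly, -⟩ := hloc.isLocalResult hab
    have hcov := hchk.mem_coverage.2
    rw [I.le_dfly_iff (I.speeds_pos v hv)] at hdfly
    rw [flightPlan, heq, List.append_assoc]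
    have hvis := hS'.mono fun x y h => hε.visible h
    have hb0 : 0 ≤ I.budget - I.cost v * pathLength S' := sub_nonneg.2 hdfly
    cases b with
    | start => exact absurd rfl hbs
    | goal =>
      refine ValidPlan.flyAlong_append (g := false) ?_ hv hvis (by simp)
      -- No edge leaves the goal, so the sequence of nodes ends here.
      cases l with
      | nil => exact .nil hb0 hcov
      | cons c l =>
        obtain ⟨_, _, _, hgoal, -⟩ := hloc.isLocalResult (isVisitingSeq_cons_cons.1 hb).1
        exact absurd rfl hgoal
    | cs k =>
      refine ValidPlan.flyAlong_append (g := true) (.dock hb0 (ih hcov)) hv hvis fun _ => ?_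
      cases a with
      | start => exact Or.inr rfl
      | goal => exact absurd rfl ha
      | cs m => exact Or.inl fun h => hne (by rw [I.c_injective h])

theorem IsLocalTable.isFeasible_findPath (hloc : I.IsLocalTable ε loc) (hε : I.IsExactStep ε)
    {S : List (Node N)} (h : IsVisitingSeq (adjGlob loc) Node.start Node.goal S) :
    I.IsFeasible (I.findPath loc S) ∧
      I.totalEnergy (I.findPath loc S) = aggWeight (I.weightGlob loc) S := by
  have hcov : I.pos Node.start ∈ I.coverage := by
    obtain ⟨l, rfl⟩ := h.exists_eq_cons
    cases l with
    | nil => simp [IsVisitingSeq] at h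
    | cons n l =>
      obtain ⟨_, _, _, _, _, _, hchk, -⟩ := hloc.isLocalResult (isVisitingSeq_cons_cons.1 h).1
      exact hchk.mem_coverage.1
  have hplan := hloc.validPlan_flightPlan hε h hcov
  exact ⟨hplan.isFeasible, hplan.totalEnergy_eq.trans (hloc.planCost_flightPlan h)⟩

/-! ### The global graph is at least as good as any feasible trajectory -/

/-- The global graph has a path of aggregate weight at most `W` from the initial point to `n`. -/
def Reach (I : Mission M N) (loc : LocalTable N) (n : Node N) (W : ℝ) : Prop :=
  ∃ S, IsVisitingSeq (adjGlob loc) Node.start n S ∧ aggWeight (I.weightGlob loc) S ≤ W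

theorem reach_start {W : ℝ} (hW : 0 ≤ W) : I.Reach loc Node.start W :=
  ⟨[Node.start], isVisitingSeq_singleton, hW⟩

theorem Reach.mono {n : Node N} {W W' : ℝ} (h : I.Reach loc n W) (hW : W ≤ W') :
    I.Reach loc n W' :=
  let ⟨S, hS, hle⟩ := h
  ⟨S, hS, hle.trans hW⟩

theorem Reach.nonneg {n : Node N} {W : ℝ} (h : I.Reach loc n W)
    (hloc : I.IsLocalTable ε loc) : 0 ≤ W :=
  let ⟨S, _, hle⟩ := h
  (aggWeight_nonneg hloc.weightGlob_nonneg S).trans hle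

/-- A speed of least cost can fly the length of `S`, hence also the Dijkstra length. So the table
has an entry for the pair, its speed has least cost, and its path is no longer than `S`. -/
theorem Reach.step {n n' : Node N} {W : ℝ} {S : List Plane} (h : I.Reach loc n W)
    (hloc : I.IsLocalTable ε loc) (hε : I.IsExactStep ε) (hn : n ≠ Node.goal)
    (hn' : n' ≠ Node.start) (hne : n ≠ n')
    (hS : IsVisitingSeq (I.adjLoc ε n n') (I.pos n) (I.pos n') S)
    (hcov : I.pos n' ∈ I.coverage) (hb : I.minCost * pathLength S ≤ I.budget) :
    I.Reach loc n' (W + I.minCost * pathLength S) := by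
  obtain ⟨S₀, hS₀⟩ := exists_isDijkstraOutput (wt := fun x y : Plane => ‖x - y‖)
    (finite_Vloc n n') (fun x y h => ⟨h.1, h.2.1⟩) (fun _ _ => norm_nonneg _) hS
  have hchk : I.ChkFea (I.pos n) (I.pos n') :=
    chkFea_of_isVisitingSeq (hS.mono fun x y h => hε.visible h) hcov
  obtain ⟨v₀, hv₀, hmin⟩ := I.exists_cost_eq_minCost
  have hle : ∀ S', IsDijkstraOutput (I.adjLoc ε n n') (fun x y => ‖x - y‖) (I.pos n) (I.pos n') S' →
      pathLength S' ≤ I.dfly v₀ := by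
    intro S' hS'
    rw [I.le_dfly_iff (I.speeds_pos v₀ hv₀), ← hmin]
    exact (mul_le_mul_of_nonneg_left (hS'.2 S hS) I.minCost_pos.le).trans hb
  have hsome : adjGlob loc n n' := by
    by_contra hnone
    rw [adjGlob, Bool.not_eq_true, Option.isSome_eq_false_iff, Option.isNone_iff_eq_none] at hnone
    refine (hloc n n').2 hnone S₀ v₀ ⟨hn, hn', hne, hchk, hS₀, hv₀, hle S₀ hS₀, ?_⟩
    exact fun v' hv' _ => hmin.symm.trans_le (I.minCost_le hv')
  obtain ⟨S₁, v₁, heq, -, -, -, -, hS₁, hv₁, hd₁, hbest⟩ := hloc.isLocalResult hsome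
  obtain ⟨R, hR, hRW⟩ := h
  refine ⟨R ++ [n'], hR.concat hsome, ?_⟩
  rw [hR.aggWeight_concat, hloc.weightGlob_eq heq]
  refine add_le_add hRW ?_
  have hcost : I.cost v₁ ≤ I.minCost := by
    rw [hmin]
    exact hbest v₀ hv₀ (hle S₁ hS₁)
  exact mul_le_mul hcost (hS₁.2 S hS) (pathLength_nonneg _) I.minCost_pos.le

/-- The edges that belong to the local graph of `n` and any other node. -/
def adjFrom (I : Mission M N) (ε : ℝ) (n : Node N) (x y : Plane) : Prop :=
  (x = I.pos n ∨ x ∈ I.Vin) ∧ y ∈ I.Vin ∧ (I.edgeIn ε x y ∨ I.edgeAt ε n x y)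

theorem adjFrom.adjLoc {n : Node N} {x y : Plane} (h : I.adjFrom ε n x y) (n' : Node N) :
    I.adjLoc ε n n' x y := by
  refine ⟨?_, Or.inl h.2.1, h.2.2.imp_right Or.inl⟩
  rcases h.1 with rfl | h
  exacts [Or.inr (Or.inl rfl), Or.inl h]

/-- A polygon of affordable length that ends in a node can be replaced by a path in the global
graph. -/
theorem reach_of_polygon (hloc : I.IsLocalTable ε loc) (hε : I.IsExactStep ε) {k : Node N}
    (hk : k ≠ Node.start) (hcov : I.pos k ∈ I.coverage) {W : ℝ} {z : Plane} {Z : List Plane}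
    (hZ : IsVisitingSeq I.Visible z (I.pos k) Z) :
    (∀ y ∈ Z, y ∈ I.Vall) → ∀ {n : Node N} {S : List Plane} {W' : ℝ}, n ≠ Node.goal →
    I.Reach loc n W' → IsVisitingSeq (I.adjFrom ε n) (I.pos n) z S →
    (z = I.pos n ∨ z ∈ I.Vin ∧ ∀ m, I.pos m ≠ z) →
    I.minCost * (pathLength S + pathLength Z) ≤ I.budget →
    W' + I.minCost * (pathLength S + pathLength Z) ≤ W →
    I.Reach loc k W ∨ I.Reach loc Node.goal W := by
  have hc := I.minCost_pos
  -- The polygon is followed vertex by vertex: `n` is the node where the current stretch began, `S`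
  -- the stretch from there to `z`. A local graph admits no edges at nodes in the interior of a
  -- stretch, so whenever a vertex is a node, the stretch is closed there. Passing the goal finishes
  -- the path early, whence the second alternative. A new stretch begins with the full budget.
  refine hZ.induction (motive := fun z Z => (∀ y ∈ Z, y ∈ I.Vall) →
    ∀ {n : Node N} {S : List Plane} {W' : ℝ}, n ≠ Node.goal →
    I.Reach loc n W' → IsVisitingSeq (I.adjFrom ε n) (I.pos n) z S →
    (z = I.pos n ∨ z ∈ I.Vin ∧ ∀ m, I.pos m ≠ z) →
    I.minCost * (pathLength S + pathLength Z) ≤ I.budget →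
    W' + I.minCost * (pathLength S + pathLength Z) ≤ W →
    I.Reach loc k W ∨ I.Reach loc Node.goal W) ?_ fun x y l hxy hy ih => ?_
  · intro _ n S W' hn hR hS hz _ hW
    have hW' : W' ≤ W := by
      have := mul_nonneg hc.le (add_nonneg (pathLength_nonneg S) (pathLength_nonneg [I.pos k]))
      linarith
    rcases hz with hz | ⟨-, hz⟩
    · by_cases hnk : n = k
      · exact Or.inl (hnk ▸ hR.mono hW')
      -- Two different nodes may share a position; the one-point path then joins them at no cost.
      · refine Or.inl ((hR.step (S := [I.pos n]) hloc hε hn hk hnk ?_ hcov ?_).mono ?_)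
        · rw [← hz]
          exact isVisitingSeq_singleton
        · rw [pathLength_singleton, mul_zero]
          exact I.budget_pos.le
        · rwa [pathLength_singleton, mul_zero, add_zero]
    · exact absurd rfl (hz k)
  · intro hV n S W' hn hR hS hz hb hW
    have hxV := hV x List.mem_cons_self
    have hV' : ∀ y' ∈ y :: l, y' ∈ I.Vall := fun y' h => hV y' (List.mem_cons_of_mem _ h)
    have hyV := hV' y List.mem_cons_self
    have hsurv : I.Survives ε x y := (hε x y).2 ⟨hxV, hyV, hxy.1, hxy.2⟩
    have hx : x = I.pos n ∨ x ∈ I.Vin := hz.imp_right And.left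
    have hlen : pathLength (S ++ [y]) = pathLength S + ‖x - y‖ := hS.aggWeight_concat
    have hW0 := hR.nonneg hloc
    have hS0 := pathLength_nonneg S
    have hl0 := pathLength_nonneg (y :: l)
    rw [pathLength_cons_cons, ← add_assoc, ← hlen] at hb hW
    have hSy := pathLength_nonneg (S ++ [y])
    have hb₁ : I.minCost * pathLength (S ++ [y]) ≤ I.budget :=
      (mul_le_mul_of_nonneg_left (by linarith) hc.le).trans hb
    have hb₂ : I.minCost * (pathLength [y] + pathLength (y :: l)) ≤ I.budget := by
      rw [pathLength_singleton, zero_add]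
      exact (mul_le_mul_of_nonneg_left (by linarith) hc.le).trans hb
    rw [mul_add, ← add_assoc] at hW
    have hm₁ := mul_nonneg hc.le hSy
    have hm₂ := mul_nonneg hc.le hl0
    by_cases hnode : ∃ m, I.pos m = y
    · obtain ⟨m, rfl⟩ := hnode
      have hstep : m ≠ Node.start → n ≠ m →
          I.Reach loc m (W' + I.minCost * pathLength (S ++ [I.pos m])) := by
        intro hm hnm
        refine hR.step hloc hε hn hm hnm ((hS.mono fun _ _ h => h.adjLoc m).concat ?_)
          (hxy.2 (right_mem_segment ℝ _ _)) hb₁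
        refine ⟨?_, Or.inr (Or.inr rfl), Or.inr (Or.inr ⟨hsurv, Or.inr rfl⟩)⟩
        rcases hx with rfl | hx
        exacts [Or.inr (Or.inl rfl), Or.inl hx]
      have hreset : ∀ {W''}, m ≠ Node.goal → I.Reach loc m W'' →
          W'' ≤ W' + I.minCost * pathLength (S ++ [I.pos m]) →
          I.Reach loc k W ∨ I.Reach loc Node.goal W := by
        intro W'' hm hRm hle
        refine ih hV' hm hRm isVisitingSeq_singleton (Or.inl rfl) hb₂ ?_
        rw [pathLength_singleton, zero_add]
        linarith
      cases m with
      -- No edge enters the initial node, but it is reachable at weight `0`, so everything before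
      -- can be discarded.
      | start => exact hreset (by simp) (reach_start le_rfl) (by linarith)
      | goal => exact Or.inr ((hstep (by simp) hn).mono (by linarith))
      | cs m =>
        by_cases hnm : n = Node.cs m
        -- A loop back to the station where the stretch began is discarded.
        · subst hnm
          exact hreset hn hR (by linarith)
        · exact hreset (by simp) (hstep (by simp) hnm) le_rfl
    · push Not at hnode
      have hyVin : y ∈ I.Vin := by
        rcases hyV with ⟨m, hm⟩ | h
        exacts [absurd hm (hnode m), h]
      refine ih hV' hn hR (hS.concat ⟨hx, hyVin, ?_⟩) (Or.inr ⟨hyVin, hnode⟩) hb ?_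
      · rcases hz with rfl | ⟨-, hxn⟩
        · exact Or.inr ⟨hsurv, Or.inl rfl⟩
        · exact Or.inl ⟨hsurv, fun m => ⟨hxn m, hnode m⟩⟩
      · rw [mul_add, ← add_assoc]
        exact hW

namespace IsFeasible

variable {p : Trajectory N}

/-- A part of a feasible trajectory between two nodes that stays within the energy budget can be
replaced by a path in the global graph. -/
theorem reach_of_leg (hp : I.IsFeasible p) (hloc : I.IsLocalTable ε loc) (hε : I.IsExactStep ε)
    {n k : Node N} {s t W : ℝ} (hs : 0 ≤ s) (hst : s ≤ t) (ht : t ≤ p.T) (hn : n ≠ Node.goal)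
    (hk : k ≠ Node.start) (hus : p.u s = I.pos n) (hut : p.u t = I.pos k)
    (hR : I.Reach loc n W) (hE : I.energyUsed p s t ≤ I.budget) :
    I.Reach loc k (W + I.energyUsed p s t) ∨
      I.Reach loc Node.goal (W + I.energyUsed p s t) := by
  obtain ⟨Z, hZ, hmem, hlen⟩ := hp.exists_polygon hs hst ht
  have hcov := I.covered_iff.1 (hp.connected t ⟨hs.trans hst, ht⟩)
  rw [hus, hut] at hZ
  rw [hut] at hcov
  refine reach_of_polygon hloc hε hk hcov hZ ?_ hn hR isVisitingSeq_singleton (Or.inl rfl) ?_ ?_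
  · intro z hz
    rcases hmem z hz with rfl | rfl | h
    exacts [Or.inl ⟨n, hus.symm⟩, Or.inl ⟨k, hut.symm⟩, Or.inr h]
  · rw [pathLength_singleton, zero_add]
    exact hlen.trans hE
  · rw [pathLength_singleton, zero_add]
    linarith

end IsFeasible

end Mission

/-! ### Cutting a feasible trajectory into legs -/

namespace Mission

open Set Filter Topology Metric MeasureTheory

variable {M N : ℕ} {I : Mission M N} {ε : ℝ} {loc : LocalTable N} {p : Trajectory N}

namespace IsFeasible

theorem lastFull_mem_Icc (I : Mission M N) (p : Trajectory N) {t : ℝ} (ht : 0 ≤ t) :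
    I.lastFull p t ∈ Icc 0 t := by
  have hub : ∀ a ∈ insert 0 {s | s ∈ Icc 0 t ∧ I.IsSwap p s}, a ≤ t := by
    rintro a (rfl | ha)
    exacts [ht, ha.1.2]
  exact ⟨le_csSup ⟨t, hub⟩ (mem_insert _ _), csSup_le (insert_nonempty _ _) hub⟩

variable (hp : I.IsFeasible p)

include hp

theorem exists_eq_c_of_isSwap {t : ℝ} (ht : t ∈ Icc 0 p.T) (h : I.IsSwap p t) :
    ∃ n, p.u t = I.c n := by
  obtain ⟨n, hn, -⟩ := h
  exact hp.exists_eq_c_of_ne_none ht (by simp [hn])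

theorem energyUsed_lastFull_le {t : ℝ} (ht : t ∈ Icc 0 p.T) :
    I.energyUsed p (I.lastFull p t) t ≤ I.budget := by
  have h := hp.energy t ht
  rw [battery] at h
  have : (1 - I.gam / I.rsafe) * I.capacity = I.capacity - I.budget := by
    rw [budget]
    ring
  linarith

/-- The last time with a fresh battery is the initial time or spent at a CS. -/
theorem lastFull_eq_zero_or {t : ℝ} (ht : t ∈ Icc 0 p.T) :
    I.lastFull p t = 0 ∨ ∃ n, p.u (I.lastFull p t) = I.c n := by
  have hcont : ContinuousOn p.u (Icc 0 t) := hp.continuousOn.mono (Icc_subset_Icc_right ht.2)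
  -- The supremum of the replacement times need not be one of them, but the times spent at charging
  -- stations form a closed set.
  have hclosed : IsClosed ({0} ∪ Icc 0 t ∩ p.u ⁻¹' range I.c) :=
    isClosed_singleton.union
      (hcont.preimage_isClosed_of_isClosed isClosed_Icc (finite_range I.c).isClosed)
  have hsub : insert 0 {s | s ∈ Icc 0 t ∧ I.IsSwap p s} ⊆
      {0} ∪ Icc 0 t ∩ p.u ⁻¹' range I.c := by
    rintro s (rfl | ⟨hs, hswap⟩)
    · exact Or.inl rfl
    · obtain ⟨n, hn⟩ := hp.exists_eq_c_of_isSwap ⟨hs.1, hs.2.trans ht.2⟩ hswap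
      exact Or.inr ⟨hs, n, hn.symm⟩
  have hbdd : BddAbove (insert 0 {s | s ∈ Icc 0 t ∧ I.IsSwap p s}) :=
    BddAbove.insert 0 ⟨t, fun s hs => hs.1.2⟩
  rcases hclosed.closure_subset_iff.2 hsub (csSup_mem_closure (insert_nonempty _ _) hbdd) with
    h | ⟨-, n, hn⟩
  exacts [Or.inl h, Or.inr ⟨n, hn.symm⟩]

/-- Before the first visit to a CS, the battery was fresh at the initial time or at another CS, and
the consumption since then is within the budget. -/
theorem exists_leg_start {t₁ : ℝ} (ht₁ : 0 < t₁) (hT : t₁ ≤ p.T) {n : Fin N}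
    (hn : p.u t₁ = I.c n) (hfirst : ∀ t, 0 ≤ t → t < t₁ → p.u t ≠ I.c n) :
    ∃ s, 0 ≤ s ∧ s < t₁ ∧ (s = 0 ∨ ∃ m, p.u s = I.c m) ∧ I.energyUsed p s t₁ ≤ I.budget := by
  -- A replacement at `t₁` itself would hide the previous leg, so times just before `t₁` are used:
  -- by continuity no other station is visited there, and `n` is not visited before `t₁`.
  have hfree : ∀ᶠ t in 𝓝[<] t₁, ∀ m, m ≠ n → p.u t ≠ I.c m := by
    rw [eventually_all]
    intro m
    by_cases hm : m = n
    · exact Eventually.of_forall fun _ h => absurd hm h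
    have hc : ContinuousWithinAt p.u (Iio t₁) t₁ := by
      have := (hp.continuousOn t₁ ⟨ht₁.le, hT⟩).mono
        (Ico_subset_Icc_self.trans (Icc_subset_Icc_right hT) : Ico 0 t₁ ⊆ Icc 0 p.T)
      rwa [ContinuousWithinAt, nhdsWithin_Ico_eq_nhdsLT ht₁] at this
    have hne : p.u t₁ ≠ I.c m := fun h => hm (I.c_injective (h.symm.trans hn))
    exact (hc.eventually_ne hne).mono fun t ht _ => ht
  obtain ⟨r, hr, hfree⟩ := (mem_nhdsLT_iff_exists_Ioo_subset' ht₁).1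
    (hfree.and (Ico_mem_nhdsLT ht₁))
  obtain ⟨t', hrt, htt⟩ := exists_between (show r < t₁ from hr)
  have ht'0 : 0 ≤ t' := (hfree ⟨hrt, htt⟩).2.1
  have hlast : ∀ t, t' ≤ t → t < t₁ → I.lastFull p t = I.lastFull p t' := by
    intro t h₁ h₂
    rw [lastFull, lastFull]
    congr 2
    ext s
    refine ⟨fun ⟨hs, hsw⟩ => ⟨⟨hs.1, ?_⟩, hsw⟩, fun ⟨hs, hsw⟩ => ⟨⟨hs.1, hs.2.trans h₁⟩, hsw⟩⟩
    by_contra! hlt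
    have hs₁ := hs.2.trans_lt h₂
    obtain ⟨m, hm⟩ := hp.exists_eq_c_of_isSwap ⟨hs.1, hs₁.le.trans hT⟩ hsw
    by_cases hmn : m = n
    · exact hfirst s hs.1 hs₁ (hmn ▸ hm)
    · exact (hfree ⟨hrt.trans hlt, hs₁⟩).1 m hmn hm
  have hmem := lastFull_mem_Icc I p ht'0
  set s := I.lastFull p t'
  have hst : s < t₁ := hmem.2.trans_lt htt
  refine ⟨s, hmem.1, hst, hp.lastFull_eq_zero_or ⟨ht'0, htt.le.trans hT⟩, ?_⟩
  -- The battery constraint bounds the consumption since `s` at all times shortly before `t₁`;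
  -- continuity carries the bound to `t₁`.
  have hcont : ContinuousWithinAt (fun x => ∫ y in s..x, I.rate p y) (Iio t₁) t₁ := by
    have := intervalIntegral.continuousOn_primitive_interval (μ := volume) (f := I.rate p)
      (a := s) (b := t₁) (by
        rw [uIcc_of_le hst.le]
        exact hp.integrableOn_rate.mono_set (Icc_subset_Icc hmem.1 hT))
    rw [uIcc_of_le hst.le] at this
    have := (this t₁ (right_mem_Icc.2 hst.le)).mono Ico_subset_Icc_self
    rwa [ContinuousWithinAt, nhdsWithin_Ico_eq_nhdsLT hst] at this
  rw [hp.energyUsed_eq hmem.1 hst.le hT]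
  refine le_of_tendsto hcont.tendsto ?_
  filter_upwards [Ico_mem_nhdsLT htt] with t ht
  rw [← hp.energyUsed_eq hmem.1 (hmem.2.trans ht.1) (ht.2.le.trans hT), ← hlast t ht.1 ht.2]
  exact hp.energyUsed_lastFull_le ⟨ht'0.trans ht.1, ht.2.le.trans hT⟩

/-- The times spent at different CSs are apart. -/
theorem exists_separation : ∃ δ, 0 < δ ∧ ∀ s ∈ Icc 0 p.T, ∀ t ∈ Icc 0 p.T, ∀ m n, m ≠ n →
    p.u s = I.c m → p.u t = I.c n → s ≤ t → s + δ ≤ t := by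
  obtain ⟨K, hK⟩ := hp.lipschitz
  have hd : ∀ᶠ d in 𝓝[>] (0 : ℝ), ∀ m n, m ≠ n → d ≤ dist (I.c m) (I.c n) := by
    simp only [eventually_all]
    intro m n hmn
    filter_upwards [Ioc_mem_nhdsGT (dist_pos.2 fun h => hmn (I.c_injective h))] with d hd
    exact hd.2
  obtain ⟨d, hd, hd0⟩ := (hd.and self_mem_nhdsWithin).exists
  have hK1 : (0 : ℝ) < K + 1 := by positivity
  refine ⟨d / (K + 1), div_pos hd0 hK1, fun s hs t ht m n hmn hm hn hst => ?_⟩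
  have h₁ := hK.dist_le_mul s hs t ht
  rw [hm, hn, dist_comm s t, Real.dist_eq, abs_of_nonneg (sub_nonneg.2 hst)] at h₁
  have h₂ := hd m n hmn
  have : d / (K + 1) ≤ t - s := by
    rw [div_le_iff₀ hK1]
    linarith
  linarith

/-- The leg into a station comes from the start or from a different station, visited at least `δ`
earlier. So going back leg by leg ends after finitely many steps, which is an induction on the time
in units of `δ`. -/
theorem reach_cs (hloc : I.IsLocalTable ε loc) (hε : I.IsExactStep ε) {t : ℝ}
    (ht : t ∈ Icc 0 p.T) {n : Fin N} (hn : p.u t = I.c n) :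
    I.Reach loc (Node.cs n) (I.energyUsed p 0 t) ∨
      I.Reach loc Node.goal (I.energyUsed p 0 t) := by
  obtain ⟨δ, hδ, hsep⟩ := hp.exists_separation
  suffices h : ∀ k : ℕ, ∀ t ∈ Icc 0 p.T, t < k * δ → ∀ n, p.u t = I.c n →
      I.Reach loc (Node.cs n) (I.energyUsed p 0 t) ∨
        I.Reach loc Node.goal (I.energyUsed p 0 t) by
    obtain ⟨k, hk⟩ := exists_nat_gt (t / δ)
    exact h k t ht ((div_lt_iff₀ hδ).1 hk) n hn
  intro k
  induction k with
  | zero =>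
    intro t ht hlt
    rw [Nat.cast_zero, zero_mul] at hlt
    exact absurd ht.1 (not_le.2 hlt)
  | succ k ih =>
    intro t ht hlt n hn
    have hcont : ContinuousOn p.u (Icc 0 t) := hp.continuousOn.mono (Icc_subset_Icc_right ht.2)
    obtain ⟨t₁, ⟨ht₁, hn₁⟩, hleast⟩ :=
      (isCompact_Icc.of_isClosed_subset (hcont.preimage_isClosed_of_isClosed isClosed_Icc
        (isClosed_singleton (x := I.c n))) inter_subset_left).exists_isLeast
        ⟨t, right_mem_Icc.2 ht.1, hn⟩
    have hT₁ := ht₁.2.trans ht.2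
    -- The first visit to the station suffices, since consumption only grows afterwards.
    suffices h : I.Reach loc (Node.cs n) (I.energyUsed p 0 t₁) ∨
        I.Reach loc Node.goal (I.energyUsed p 0 t₁) by
      have hmono : I.energyUsed p 0 t₁ ≤ I.energyUsed p 0 t := by
        rw [← hp.energyUsed_add le_rfl ht₁.1 ht₁.2 ht.2]
        linarith [hp.energyUsed_nonneg ht₁.1 ht₁.2 ht.2]
      exact h.imp (fun h => h.mono hmono) fun h => h.mono hmono
    have hstart : I.energyUsed p 0 t₁ ≤ I.budget →
        I.Reach loc (Node.cs n) (I.energyUsed p 0 t₁) ∨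
          I.Reach loc Node.goal (I.energyUsed p 0 t₁) := by
      intro hE
      have := hp.reach_of_leg hloc hε (n := Node.start) (k := Node.cs n) le_rfl ht₁.1 hT₁
        (by simp) (by simp) hp.initial hn₁ (reach_start le_rfl) hE
      rwa [zero_add] at this
    rcases ht₁.1.eq_or_lt with h0 | hpos
    · refine hstart ?_
      rw [← h0, hp.energyUsed_eq le_rfl le_rfl hp.time_nonneg, intervalIntegral.integral_same]
      exact I.budget_pos.le
    obtain ⟨s, hs0, hst, hs, hE⟩ := hp.exists_leg_start hpos hT₁ hn₁ fun t' h₁ h₂ h =>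
      (not_le.2 h₂) (hleast ⟨⟨h₁, h₂.le.trans ht₁.2⟩, h⟩)
    rcases hs with rfl | ⟨m, hm⟩
    · exact hstart hE
    have hmn : m ≠ n := by
      rintro rfl
      exact (not_le.2 hst) (hleast ⟨⟨hs0, hst.le.trans ht₁.2⟩, hm⟩)
    have hsI : s ∈ Icc 0 p.T := ⟨hs0, hst.le.trans hT₁⟩
    have hle := hsep s hsI t₁ ⟨ht₁.1, hT₁⟩ m n hmn hm hn₁ hst.le
    have hadd := hp.energyUsed_add le_rfl hs0 hst.le hT₁
    rcases ih s hsI (by push_cast at hlt; linarith [ht₁.2]) m hm with h | h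
    · have := hp.reach_of_leg hloc hε (n := Node.cs m) (k := Node.cs n) hs0 hst.le hT₁
        (by simp) (by simp) hm hn₁ h hE
      rwa [hadd] at this
    · refine Or.inr (h.mono ?_)
      linarith [hp.energyUsed_nonneg hs0 hst.le hT₁]

/-- Each feasible trajectory consumes at least the aggregate weight of some path in the global
graph. -/
theorem reach_goal (hloc : I.IsLocalTable ε loc) (hε : I.IsExactStep ε) :
    I.Reach loc Node.goal (I.totalEnergy p) := by
  have hTI : p.T ∈ Icc 0 p.T := right_mem_Icc.2 hp.time_nonneg
  have hE := hp.energyUsed_lastFull_le hTI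
  have hmem := lastFull_mem_Icc I p hp.time_nonneg
  have hadd := hp.energyUsed_add le_rfl hmem.1 hmem.2 le_rfl
  rcases hp.lastFull_eq_zero_or hTI with h0 | ⟨m, hm⟩
  · rw [h0] at hE
    have := hp.reach_of_leg hloc hε (n := Node.start) (k := Node.goal) le_rfl hp.time_nonneg le_rfl
      (by simp) (by simp) hp.initial hp.final (reach_start le_rfl) hE
    rwa [zero_add, or_self] at this
  · rcases hp.reach_cs hloc hε ⟨hmem.1, hmem.2⟩ hm with h | h
    · have := hp.reach_of_leg hloc hε (n := Node.cs m) (k := Node.goal) hmem.1 hmem.2 le_rfl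
        (by simp) (by simp) hm hp.final h hE
      rwa [hadd, or_self] at this
    · refine h.mono ?_
      rw [totalEnergy, ← hadd]
      linarith [hp.energyUsed_nonneg hmem.1 hmem.2 le_rfl]

end IsFeasible

end Mission

/-! ### The main theorem -/

theorem proposition1 {M N : ℕ} (I : Mission M N) :
    ∃ ε₀ : ℝ, 0 < ε₀ ∧ ∀ ε : ℝ, 0 < ε → ε < ε₀ →
      (∃ out, I.IsOutput ε out) ∧
      (∀ p, I.IsOutput ε (some p) → I.IsOptimal p) ∧
      (I.IsOutput ε none → ¬ ∃ p, I.IsFeasible p) := by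
  obtain ⟨ε₀, hε₀, hsub⟩ := mem_nhdsGT_iff_exists_Ioo_subset.1 I.eventually_survives_iff
  refine ⟨ε₀, hε₀, fun ε hpos hlt => ?_⟩
  have hε : I.IsExactStep ε := hsub ⟨hpos, hlt⟩
  refine ⟨Mission.exists_isOutput I ε, ?_, ?_⟩
  · rintro p ⟨loc, hloc, ⟨S, hS, hp⟩ | ⟨-, hp⟩⟩
    · obtain rfl := Option.some.inj hp
      obtain ⟨hfeas, hE⟩ := hloc.isFeasible_findPath hε hS.1
      refine ⟨hfeas, fun p' hp' => ?_⟩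
      obtain ⟨S', hS', hle⟩ := hp'.reach_goal hloc hε
      exact hE.trans_le ((hS.2 S' hS').trans hle)
    · simp at hp
  · rintro ⟨loc, hloc, ⟨S, -, hp⟩ | ⟨hno, -⟩⟩ ⟨p, hp'⟩
    · simp at hp
    · obtain ⟨S', hS', -⟩ := hp'.reach_goal hloc hε
      exact hno ⟨S', hS'⟩
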